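/- Let $r\in\{1,2,\dots,\infty\}$ and let $M$ be a compact $C^r$ manifold (Hausdorff, without boundary, of dimension $\dim M$) with a continuous Riemannian metric tensor; let $\rho$ be the induced Riemannian distance. (If $M$ is not connected, $\rho$ is any finite metric inducing the topology of $M$ that equals the Riemannian distance on each connected component.) Let $T:M\to M$ be a $C^r$ diffeomorphism, $X\subset M$ a compact set, $\mu$ a Borel probability measure on $X$, and $k\in\mathbb N$ such that $$\mu\Big(\bigcup_{p=1}^{k-1}\{x\in M: T^p x=x\}\Big)=0 .$$ For $h:M\to\mathbb R$ put $\phi_{h,k}(x)=(h(x),h(Tx),\dots,h(T^{k-1}x))\in\mathbb R^k$, where $\mathbb R^k$ carries the Euclidean norm $\|\cdot\|$. Equip $C^r(M,\mathbb R)$ with the topology of uniform convergence of all derivatives of (finite) order at most $r$. A Borel set $B\subset C^r(M,\mathbb R)$ is called prevalent if there is a Borel measure $\nu$ on $C^r(M,\mathbb R)$, positive and finite on some compact set, such that for every $v\in C^r(M,\mathbb R)$ one has $v+e\in B$ for $\nu$-almost every $e$; an arbitrary set is prevalent if it contains a prevalent Borel set. Then the set of all $h\in C^r(M,\mathbb R)$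 with both of the following properties is prevalent. 1. If $k>\dim_H X$ (Hausdorff dimension with respect to $\rho$) and $k\ge\dim M$, then for $\mu$-a.e. $x\in X$ there is $C=C(x,h)\in[0,\infty)$ such that $$\rho(x,y)\le C\,\|\phi_{h,k}(x)-\phi_{h,k}(y)\|\quad\text{for every } y\in X .$$ 2. If $k>\dim M$, then for $\mu$-a.e. $x\in X$ there are open neighbourhoods $U$ of $x$ in $M$ and $V$ of $\phi_{h,k}(x)$ in $\mathbb R^k$ such that $\phi_{h,k}^{-1}(V)=U$, the set $V\cap\phi_{h,k}(M)$ is an embedded $C^r$ submanifold of $\mathbb R^k$ of dimension $\dim M$, and $\phi_{h,k}$ restricts to a $C^r$ diffeomorphism from $U$ onto $V\cap\phi_{h,k}(M)$. -/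

import Mathlib

open Set Function MeasureTheory Topology Manifold Bundle
open scoped ENNReal ContDiff

noncomputable section

section Prevalence

variable {V : Type*} [AddCommGroup V] [TopologicalSpace V] [MeasurableSpace V] [BorelSpace V]

/-- A Borel set `B` is prevalent if there is a Borel measure `ν`, positive and finite on some
compact set, such that for every `v` one has `v + e ∈ B` for `ν`-almost every `e`. -/
def IsPrevalentBorel (B : Set V) : Prop :=
  MeasurableSet B ∧ ∃ ν : Measure V,
    (∃ K : Set V, IsCompact K ∧ 0 < ν K ∧ ν K < ⊤) ∧ ∀ v : V, ∀ᵐ e ∂ν, v + e ∈ B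

/-- An arbitrary set is prevalent if it contains a prevalent Borel set. -/
def IsPrevalent (S : Set V) : Prop :=
  ∃ B : Set V, B ⊆ S ∧ IsPrevalentBorel B

end Prevalence

section Observables

variable {d : ℕ} {r : ℕ∞} {M : Type*} [TopologicalSpace M]
  [ChartedSpace (EuclideanSpace ℝ (Fin d)) M]

/-- The `C^r` topology on `C^r(M, ℝ)`: uniform convergence, on compact subsets of the domains of
the charts, of all the derivatives of finite order at most `r`, read in these charts. -/
instance instTopologicalSpaceObservable :
    TopologicalSpace C^(r : ℕ∞ω)⟮𝓡 d, M; 𝓘(ℝ, ℝ), ℝ⟯ :=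
  ⨅ e : atlas (EuclideanSpace ℝ (Fin d)) M, ⨅ i : {i : ℕ // (i : ℕ∞) ≤ r},
    TopologicalSpace.induced
      (fun h ↦ UniformOnFun.ofFun
        {K : Set (EuclideanSpace ℝ (Fin d)) | IsCompact K ∧ K ⊆ e.1.target}
        (iteratedFDeriv ℝ i.1 (⇑h ∘ ⇑e.1.symm)))
      inferInstance

instance instMeasurableSpaceObservable :
    MeasurableSpace C^(r : ℕ∞ω)⟮𝓡 d, M; 𝓘(ℝ, ℝ), ℝ⟯ := borel _

instance instBorelSpaceObservable :
    BorelSpace C^(r : ℕ∞ω)⟮𝓡 d, M; 𝓘(ℝ, ℝ), ℝ⟯ := ⟨rfl⟩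

end Observables

/-- The `k`-delay coordinate map `x ↦ (h x, h (T x), …, h (T^(k-1) x))`. -/
def delayMap {M : Type*} (T : M → M) (h : M → ℝ) (k : ℕ) (x : M) : EuclideanSpace ℝ (Fin k) :=
  WithLp.toLp 2 fun i : Fin k ↦ h (T^[i] x)

/-- The distance of `M` is the Riemannian distance on each connected component of `M`. (Points of
different components are not joined by a path; on a compact manifold, the choice of finite
distances between them, compatible with the topology, only changes the metric up to a bi-Lipschitz
equivalence.) -/
def IsRiemannianMetric (d : ℕ) (M : Type*) [MetricSpace M]
    [ChartedSpace (EuclideanSpace ℝ (Fin d)) M]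
    [RiemannianBundle (fun x : M ↦ TangentSpace (𝓡 d) x)] : Prop :=
  ∀ x y : M, y ∈ connectedComponent x → edist x y = riemannianEDist (𝓡 d) x y

/-- `S` is an embedded `d`-dimensional `C^r` submanifold of `ℝ^k`: around each of its points
a `C^r` diffeomorphism between open subsets of `ℝ^k` straightens it to (an open piece of)
a `d`-dimensional linear subspace. -/
def IsEmbeddedSubmanifold (r : ℕ∞) (d : ℕ) {k : ℕ} (S : Set (EuclideanSpace ℝ (Fin k))) : Prop :=
  ∀ z ∈ S, ∃ (Ψ : OpenPartialHomeomorph (EuclideanSpace ℝ (Fin k)) (EuclideanSpace ℝ (Fin k)))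
    (L : Submodule ℝ (EuclideanSpace ℝ (Fin k))),
    z ∈ Ψ.source ∧ Module.finrank ℝ L = d ∧
      ContDiffOn ℝ r Ψ Ψ.source ∧ ContDiffOn ℝ r Ψ.symm Ψ.target ∧
      Ψ '' (S ∩ Ψ.source) = (L : Set (EuclideanSpace ℝ (Fin k))) ∩ Ψ.target

/-- `f` restricts to a `C^r` diffeomorphism between the open subset `U` of the manifold `M` and the
subset `S` of `ℝ^k`: `S` is an embedded `C^r` submanifold, `f` is a `C^r` bijection from `U` to `S`,
and its inverse `g : S → U` is `C^r`, that is, near each point of the submanifold `S`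
it is the restriction of a `C^r` map defined on an open subset of `ℝ^k`. -/
structure IsDiffeoBetween (r : ℕ∞) (d : ℕ) {k : ℕ} {M : Type*} [TopologicalSpace M]
    [ChartedSpace (EuclideanSpace ℝ (Fin d)) M]
    (f : M → EuclideanSpace ℝ (Fin k)) (U : Set M) (S : Set (EuclideanSpace ℝ (Fin k))) :
    Prop where
  isEmbeddedSubmanifold : IsEmbeddedSubmanifold r d S
  bijOn : BijOn f U S
  contMDiffOn : ContMDiffOn (𝓡 d) (𝓡 k) r f U
  exists_inverse : ∃ g : EuclideanSpace ℝ (Fin k) → M, InvOn g f U S ∧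
    ∀ z ∈ S, ∃ (W : Set (EuclideanSpace ℝ (Fin k))) (G : EuclideanSpace ℝ (Fin k) → M),
      IsOpen W ∧ z ∈ W ∧ ContMDiffOn (𝓡 k) (𝓡 d) r G W ∧ EqOn G g (W ∩ S)

end

/-!
Both properties follow from one statement about a compact set `Y ⊆ M` with `dimH Y < k` and `d ≤ k`:
for prevalent `h` and almost every `x`, the delay coordinate map `φ` has a pointwise Lipschitz
inverse at `x` on `Y`, that is, `dist x y ≤ C * ‖φ x - φ y‖` for all `y ∈ Y`. Property 1 is the case
`Y = X`. Property 2 follows from the case `Y = M`, where `dimH M ≤ d < k`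
(`IsRiemannianMetric.dimH_le`): the bound on all of `M` makes `φ` an immersion at `x` and `x` the
only preimage of `φ x`, so that the inverse function theorem and compactness of `M` give a local
diffeomorphism onto an embedded submanifold with a saturated domain
(`IsRiemannianMetric.exists_isDiffeoBetween`).

The measure witnessing prevalence is Lebesgue measure on a ball of a finite-dimensional space of
observables in which first order jets at `2 k` points can be prescribed
(`exists_interpolating_family`); such a space is a power, in the algebra `C^r(M, ℝ)`, of the span of
the constants and the bump functions and cut-off coordinates of finitely many charts. The bound
above is a Borel condition on `(x, h)` (`measurableSet_setOf_exists_dist_le`), so by Fubini's theorem it suffices to fix a point `x` which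
is not periodic of period less than `k`, and an observable `v`, and to show the bound for almost
every element of the translate of the finite-dimensional space by `v`. By differentiability near `x`
and compactness elsewhere (`IsRiemannianMetric.exists_dist_le_mul_norm_sub`), it suffices that
`φ` is an immersion at `x` and that `φ y ≠ φ x` for `y ∈ Y \ {x}`.

By disintegration of Lebesgue measure, null sets of parameters may be recognized on translates of a
subspace adapted to the situation. For immersivity (`ae_exists_injective_hasFDerivAt_delayMap`) this
is a line, along which the differential is `B + t J` with `J` injective. For injectivity
(`ae_forall_delayMap_ne`) it is a `k`-dimensional subspace on which the differences of the delay
coordinates of `x` and of a point near `y₀` are nondegenerate affine functions: the parameters with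
`φ y = φ x` for some `y ∈ Y` near `y₀` form a Lipschitz image of a subset of `Y`, which is null as
`dimH Y < k`. The finitely many `y` for which this is impossible, as one of `y, …, T^[k-1] y` is
one of `x, …, T^[k-1] x`, are treated one by one.
-/

/-! ### The topology of the space of observables -/

section ObservableTopology

variable {d : ℕ} {r : ℕ∞} {M : Type*} [TopologicalSpace M]
  [ChartedSpace (EuclideanSpace ℝ (Fin d)) M]

/-- The space `C^r(M, ℝ)` of observables on a `d`-dimensional manifold. -/
abbrev Observable (d : ℕ) (r : ℕ∞) (M : Type*) [TopologicalSpace M]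
    [ChartedSpace (EuclideanSpace ℝ (Fin d)) M] :=
  C^(r : ℕ∞ω)⟮𝓡 d, M; 𝓘(ℝ, ℝ), ℝ⟯

/-- Continuity into `C^r(M, ℝ)` means local uniform convergence of all derivatives of order at most
`r` in the charts. -/
theorem Observable.continuous_iff {Z : Type*} [TopologicalSpace Z] {F : Z → Observable d r M} :
    Continuous F ↔ ∀ e ∈ atlas (EuclideanSpace ℝ (Fin d)) M, ∀ i : ℕ, (i : ℕ∞) ≤ r →
      ∀ K : Set (EuclideanSpace ℝ (Fin d)), IsCompact K → K ⊆ e.target → ∀ z₀ : Z,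
        TendstoUniformlyOn (fun z y ↦ iteratedFDeriv ℝ i (F z ∘ e.symm) y)
          (iteratedFDeriv ℝ i (F z₀ ∘ e.symm)) (𝓝 z₀) K := by
  rw [continuous_iInf_rng]
  simp only [continuous_iInf_rng, continuous_induced_rng, Subtype.forall]
  refine forall₂_congr fun e he ↦ forall₂_congr fun i hi ↦ ?_
  rw [continuous_iff_continuousAt]
  simp only [ContinuousAt, UniformOnFun.tendsto_iff_tendstoUniformlyOn]
  constructor
  · intro h K hK hKe z₀
    exact h z₀ K ⟨hK, hKe⟩
  · intro h z₀ K hK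
    exact h K hK.1 hK.2 z₀

theorem Observable.contDiffOn_comp_symm [IsManifold (𝓡 d) r M] (f : Observable d r M)
    {e : OpenPartialHomeomorph M (EuclideanSpace ℝ (Fin d))}
    (he : e ∈ atlas (EuclideanSpace ℝ (Fin d)) M) :
    ContDiffOn ℝ r (f ∘ e.symm) e.target := by
  rw [← contMDiffOn_iff_contDiffOn]
  exact f.contMDiff.comp_contMDiffOn
    (contMDiffOn_symm_of_mem_maximalAtlas (IsManifold.subset_maximalAtlas he))

theorem Observable.contDiffAt_comp_symm [IsManifold (𝓡 d) r M] (f : Observable d r M)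
    {e : OpenPartialHomeomorph M (EuclideanSpace ℝ (Fin d))}
    (he : e ∈ atlas (EuclideanSpace ℝ (Fin d)) M) {y : EuclideanSpace ℝ (Fin d)}
    (hy : y ∈ e.target) : ContDiffAt ℝ r (f ∘ e.symm) y :=
  (f.contDiffOn_comp_symm he).contDiffAt (e.open_target.mem_nhds hy)

theorem Observable.iteratedFDeriv_add [IsManifold (𝓡 d) r M] (f g : Observable d r M)
    {e : OpenPartialHomeomorph M (EuclideanSpace ℝ (Fin d))}
    (he : e ∈ atlas (EuclideanSpace ℝ (Fin d)) M) {y : EuclideanSpace ℝ (Fin d)}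
    (hy : y ∈ e.target) {i : ℕ} (hi : (i : ℕ∞) ≤ r) :
    iteratedFDeriv ℝ i (⇑(f + g) ∘ e.symm) y =
      iteratedFDeriv ℝ i (f ∘ e.symm) y + iteratedFDeriv ℝ i (g ∘ e.symm) y :=
  iteratedFDeriv_add_apply ((f.contDiffAt_comp_symm he hy).of_le (by exact_mod_cast hi))
    ((g.contDiffAt_comp_symm he hy).of_le (by exact_mod_cast hi))

theorem Observable.continuous_const_add [IsManifold (𝓡 d) r M] (v : Observable d r M) :
    Continuous fun f : Observable d r M ↦ v + f := by
  refine Observable.continuous_iff.2 fun e he i hi K hK hKe f₀ ↦ ?_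
  have h := Observable.continuous_iff.1 (continuous_id (X := Observable d r M))
    e he i hi K hK hKe f₀
  rw [Metric.tendstoUniformlyOn_iff] at h ⊢
  intro ε hε
  filter_upwards [h ε hε] with f hf y hy
  rw [Observable.iteratedFDeriv_add _ _ he (hKe hy) hi,
    Observable.iteratedFDeriv_add _ _ he (hKe hy) hi, dist_add_left]
  exact hf y hy

/-- Finite-dimensional families of observables are continuous in the `C^r` topology, because
`iteratedFDeriv` is linear on `C^r` functions and bounded on compact subsets of a chart. -/
theorem Observable.continuous_linearCombination [IsManifold (𝓡 d) r M] {m : ℕ}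
    (b : Fin m → Observable d r M) :
    Continuous fun a : Fin m → ℝ ↦ ∑ j, a j • b j := by
  refine Observable.continuous_iff.2 fun e he i hi K hK hKe a₀ ↦ ?_
  have hi' : (i : ℕ∞ω) ≤ (r : ℕ∞ω) := by exact_mod_cast hi
  have hlin : ∀ a : Fin m → ℝ, ∀ y ∈ K,
      iteratedFDeriv ℝ i (⇑(∑ j, a j • b j) ∘ e.symm) y =
        ∑ j, a j • iteratedFDeriv ℝ i (b j ∘ e.symm) y := by
    intro a y hy
    have hc : ⇑(∑ j, a j • b j) ∘ e.symm = fun z ↦ ∑ j, (a j • (b j ∘ e.symm)) z := by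
      ext z
      have := congrFun (map_sum (ContMDiffMap.coeFnLinearMap (𝕜 := ℝ) (I := 𝓡 d) (N := M)
        (V := ℝ) (n := r)) (fun j ↦ a j • b j) Finset.univ) (e.symm z)
      simpa using this
    rw [hc, iteratedFDeriv_fun_sum_apply]
    · refine Finset.sum_congr rfl fun j _ ↦ ?_
      exact iteratedFDeriv_const_smul_apply (((b j).contDiffAt_comp_symm he (hKe hy)).of_le hi')
    · intro j _
      exact ContDiffAt.const_smul (a j) (((b j).contDiffAt_comp_symm he (hKe hy)).of_le hi')
  have hbd : ∀ j, ∃ C, ∀ y ∈ K, ‖iteratedFDeriv ℝ i (b j ∘ e.symm) y‖ ≤ C := by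
    intro j
    refine hK.exists_bound_of_continuousOn fun y hy ↦ ?_
    exact (((b j).contDiffAt_comp_symm he (hKe hy)).of_le hi').continuousAt_iteratedFDeriv
      le_rfl |>.continuousWithinAt
  choose C hC using hbd
  rw [Metric.tendstoUniformlyOn_iff]
  intro ε hε
  have hcont : Continuous fun a : Fin m → ℝ ↦ ∑ j, |a₀ j - a j| * C j := by fun_prop
  have hev : ∀ᶠ a in 𝓝 a₀, ∑ j, |a₀ j - a j| * C j < ε :=
    hcont.continuousAt.eventually_lt continuousAt_const (by simpa using hε)
  filter_upwards [hev] with a ha y hy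
  refine lt_of_le_of_lt ?_ ha
  rw [hlin _ _ hy, hlin _ _ hy, dist_eq_norm, ← Finset.sum_sub_distrib]
  refine (norm_sum_le _ _).trans (Finset.sum_le_sum fun j _ ↦ ?_)
  rw [← sub_smul, norm_smul]
  exact mul_le_mul_of_nonneg_left (hC j y hy) (norm_nonneg _)

/-- Evaluation is jointly continuous: near a point, `C^r` convergence includes uniform convergence
of the functions themselves, which are their derivatives of order zero. -/
theorem Observable.continuous_eval :
    Continuous fun p : M × Observable d r M ↦ p.2 p.1 := by
  rw [continuous_iff_continuousAt]
  rintro ⟨x₀, f₀⟩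
  set e := chartAt (EuclideanSpace ℝ (Fin d)) x₀ with he
  obtain ⟨ρ, hρ, hball⟩ : ∃ ρ > 0, Metric.closedBall (e x₀) ρ ⊆ e.target :=
    Metric.nhds_basis_closedBall.mem_iff.1 (e.open_target.mem_nhds
      (e.map_source (mem_chart_source _ x₀)))
  have h := Observable.continuous_iff.1 (continuous_id (X := Observable d r M)) e
    (chart_mem_atlas _ _) 0 (by simp) _ (isCompact_closedBall (e x₀) ρ) hball f₀
  rw [Metric.tendstoUniformlyOn_iff] at h
  rw [Metric.continuousAt_iff']
  intro ε hε
  have h1 := h (ε / 2) (half_pos hε)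
  have h2 : ∀ᶠ x in 𝓝 x₀, dist (f₀ x) (f₀ x₀) < ε / 2 :=
    Metric.continuousAt_iff'.1 f₀.contMDiff.continuous.continuousAt _ (half_pos hε)
  have h3 : ∀ᶠ x in 𝓝 x₀, e x ∈ Metric.closedBall (e x₀) ρ :=
    (e.continuousAt (mem_chart_source _ x₀)).preimage_mem_nhds (Metric.closedBall_mem_nhds _ hρ)
  have h4 : ∀ᶠ x in 𝓝 x₀, x ∈ e.source := e.open_source.mem_nhds (mem_chart_source _ x₀)
  rw [nhds_prod_eq]
  filter_upwards [(h2.and (h3.and h4)).prod_mk h1] with p hp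
  obtain ⟨⟨hp2, hp3, hp4⟩, hp1⟩ := hp
  have h5 := hp1 (e p.1) hp3
  rw [iteratedFDeriv_zero_eq_comp, iteratedFDeriv_zero_eq_comp] at h5
  simp only [comp_apply, LinearIsometryEquiv.dist_map, e.left_inv hp4, id] at h5
  calc dist (p.2 p.1) (f₀ x₀) ≤ dist (p.2 p.1) (f₀ p.1) + dist (f₀ p.1) (f₀ x₀) :=
        dist_triangle _ _ _
    _ < ε / 2 + ε / 2 := add_lt_add (by rwa [dist_comm]) hp2
    _ = ε := add_halves ε

end ObservableTopology

/-! ### Riemannian distance and charts -/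

section RiemannianDistance

open scoped NNReal

-- These put the norm of the model space on its tangent spaces, as in the bounds for the
-- differential of charts in Mathlib.
attribute [local instance] normedAddCommGroupTangentSpaceVectorSpace
attribute [local instance] normedSpaceTangentSpaceVectorSpace

variable {d : ℕ} {M : Type*} [MetricSpace M]
  [ChartedSpace (EuclideanSpace ℝ (Fin d)) M]
  [RiemannianBundle (fun x : M ↦ TangentSpace (𝓡 d) x)]

/-- Integrate the bound on the differential along paths from `x` to `y`. -/
theorem edist_le_mul_riemannianEDist {f : M → ℝ} (hf : ContMDiff (𝓡 d) 𝓘(ℝ, ℝ) 1 f) {C : ℝ≥0}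
    (hC0 : 0 < C) (hC : ∀ (y : M) (v : TangentSpace (𝓡 d) y),
      ‖letI w : ℝ := mfderiv (𝓡 d) 𝓘(ℝ, ℝ) f y v; w‖ₑ ≤ C * ‖v‖ₑ) (x y : M) :
    edist (f x) (f y) ≤ C * riemannianEDist (𝓡 d) x y := by
  by_contra! hlt
  have hC0' : (C : ℝ≥0∞) ≠ 0 := by exact_mod_cast hC0.ne'
  have hlt' : riemannianEDist (𝓡 d) x y < edist (f x) (f y) / C := by
    rw [ENNReal.lt_div_iff_mul_lt (Or.inl hC0') (Or.inl ENNReal.coe_ne_top), mul_comm]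
    exact hlt
  obtain ⟨γ, h0, h1, hγ, hlen⟩ := exists_lt_of_riemannianEDist_lt hlt'
  rw [ENNReal.lt_div_iff_mul_lt (Or.inl hC0') (Or.inl ENNReal.coe_ne_top), mul_comm] at hlen
  refine absurd hlen (not_lt.2 ?_)
  have hsm : ContDiffOn ℝ 1 (f ∘ γ) (Icc 0 1) := by
    rw [← contMDiffOn_iff_contDiffOn]
    exact hf.comp_contMDiffOn hγ
  calc edist (f x) (f y) = ‖(f ∘ γ) 1 - (f ∘ γ) 0‖ₑ := by
        rw [edist_comm, edist_eq_enorm_sub]; simp [h0, h1]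
    _ ≤ ∫⁻ t in Icc 0 1, ‖derivWithin (f ∘ γ) (Icc 0 1) t‖ₑ :=
      enorm_sub_le_lintegral_derivWithin_Icc_of_contDiffOn_Icc hsm zero_le_one
    _ ≤ ∫⁻ t in Icc (0 : ℝ) 1, C * ‖mfderivWithin 𝓘(ℝ, ℝ) (𝓡 d) γ (Icc 0 1) t 1‖ₑ := by
      apply setLIntegral_mono' measurableSet_Icc (fun t ht ↦ ?_)
      have hcomp : mfderivWithin 𝓘(ℝ, ℝ) 𝓘(ℝ, ℝ) (f ∘ γ) (Icc 0 1) t =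
          (mfderiv (𝓡 d) 𝓘(ℝ, ℝ) f (γ t)) ∘L (mfderivWithin 𝓘(ℝ, ℝ) (𝓡 d) γ (Icc 0 1) t) := by
        apply mfderiv_comp_mfderivWithin
        · exact hf.mdifferentiable one_ne_zero _
        · exact hγ.mdifferentiableOn one_ne_zero t ht
        · rw [uniqueMDiffWithinAt_iff_uniqueDiffWithinAt]
          exact uniqueDiffOn_Icc zero_lt_one _ ht
      have h2 : derivWithin (f ∘ γ) (Icc 0 1) t =
          mfderiv (𝓡 d) 𝓘(ℝ, ℝ) f (γ t) (mfderivWithin 𝓘(ℝ, ℝ) (𝓡 d) γ (Icc 0 1) t 1) := by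
        rw [← fderivWithin_derivWithin, ← mfderivWithin_eq_fderivWithin, hcomp]
        rfl
      rw [h2]
      exact hC _ _
    _ = C * pathELength (𝓡 d) γ 0 1 := by
      rw [lintegral_const_mul' _ _ ENNReal.coe_ne_top, pathELength_eq_lintegral_mfderivWithin_Icc]

variable [IsManifold (𝓡 d) 1 M]
  [IsContinuousRiemannianBundle (EuclideanSpace ℝ (Fin d)) (fun x : M ↦ TangentSpace (𝓡 d) x)]

/-- The differential of a `C^1` function is locally bounded for the Riemannian norm: factor the
function through a chart. -/
theorem eventually_enorm_mfderiv_apply_le {f : M → ℝ} (hf : ContMDiff (𝓡 d) 𝓘(ℝ, ℝ) 1 f) (x : M) :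
    ∃ C : ℝ≥0, ∀ᶠ y in 𝓝 x, ∀ v : TangentSpace (𝓡 d) y,
      ‖letI w : ℝ := mfderiv (𝓡 d) 𝓘(ℝ, ℝ) f y v; w‖ₑ ≤ C * ‖v‖ₑ := by
  obtain ⟨C, -, hC⟩ := eventually_enorm_mfderiv_extChartAt_lt (𝓡 d) x
  set e := chartAt (EuclideanSpace ℝ (Fin d)) x with he
  have hsm : ContDiffOn ℝ 1 (f ∘ e.symm) e.target := by
    rw [← contMDiffOn_iff_contDiffOn]
    exact hf.comp_contMDiffOn (contMDiffOn_symm_of_mem_maximalAtlas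
      (IsManifold.subset_maximalAtlas (chart_mem_atlas _ _)))
  have hcont : ContinuousOn (fderiv ℝ (f ∘ e.symm)) e.target :=
    hsm.continuousOn_fderiv_of_isOpen e.open_target le_rfl
  have hx : x ∈ e.source := mem_chart_source _ x
  have hat : ContinuousAt (fun y ↦ ‖fderiv ℝ (f ∘ e.symm) (e y)‖) x :=
    (ContinuousAt.comp (hcont.continuousAt (e.open_target.mem_nhds (e.map_source hx)))
      (e.continuousAt hx)).norm
  set K : ℝ≥0 := ‖fderiv ℝ (f ∘ e.symm) (e x)‖₊ + 1
  have hK : ∀ᶠ y in 𝓝 x, ‖fderiv ℝ (f ∘ e.symm) (e y)‖ < K :=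
    hat.eventually_lt continuousAt_const (by simp [K])
  refine ⟨K * C, ?_⟩
  filter_upwards [hC, hK, e.open_source.mem_nhds hx] with y hyC hyK hy v
  have hcomp : mfderiv (𝓡 d) 𝓘(ℝ, ℝ) f y =
      (fderiv ℝ (f ∘ e.symm) (e y)).comp
        (mfderiv (𝓡 d) 𝓘(ℝ, EuclideanSpace ℝ (Fin d)) (extChartAt (𝓡 d) x) y) := by
    have h1 : HasMFDerivAt (𝓡 d) 𝓘(ℝ, EuclideanSpace ℝ (Fin d)) (extChartAt (𝓡 d) x) y
        (mfderiv (𝓡 d) 𝓘(ℝ, EuclideanSpace ℝ (Fin d)) (extChartAt (𝓡 d) x) y) :=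
      (mdifferentiableAt_extChartAt hy).hasMFDerivAt
    have h2 : HasMFDerivAt 𝓘(ℝ, EuclideanSpace ℝ (Fin d)) 𝓘(ℝ, ℝ) (f ∘ e.symm)
        (extChartAt (𝓡 d) x y) (fderiv ℝ (f ∘ e.symm) (e y)) := by
      have h3 : DifferentiableAt ℝ (f ∘ e.symm) (e y) :=
        (hsm.contDiffAt (e.open_target.mem_nhds (e.map_source hy))).differentiableAt one_ne_zero
      have := h3.hasFDerivAt.hasMFDerivAt
      exact this
    have h4 := h2.comp y h1
    refine (h4.congr_of_eventuallyEq ?_).mfderiv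
    filter_upwards [e.open_source.mem_nhds hy] with z hz
    simp [← he, e.left_inv hz]
  rw [hcomp]
  change ‖fderiv ℝ (f ∘ e.symm) (e y)
    (mfderiv (𝓡 d) 𝓘(ℝ, EuclideanSpace ℝ (Fin d)) (extChartAt (𝓡 d) x) y v)‖ₑ ≤ _
  have h5 : ‖fderiv ℝ (f ∘ e.symm) (e y)‖ₑ ≤ K := by
    rw [enorm_eq_nnnorm]; exact_mod_cast hyK.le
  refine (ContinuousLinearMap.le_opENorm _ _).trans ?_
  rw [ENNReal.coe_mul, mul_assoc]
  refine mul_le_mul' h5 ?_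
  exact (ContinuousLinearMap.le_opENorm
    (mfderiv (𝓡 d) 𝓘(ℝ, EuclideanSpace ℝ (Fin d)) (extChartAt (𝓡 d) x) y) v).trans
    (mul_le_mul' hyC.le le_rfl)

theorem exists_enorm_mfderiv_apply_le [CompactSpace M] {f : M → ℝ}
    (hf : ContMDiff (𝓡 d) 𝓘(ℝ, ℝ) 1 f) :
    ∃ C : ℝ≥0, 0 < C ∧ ∀ (y : M) (v : TangentSpace (𝓡 d) y),
      ‖letI w : ℝ := mfderiv (𝓡 d) 𝓘(ℝ, ℝ) f y v; w‖ₑ ≤ C * ‖v‖ₑ := by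
  choose C hC using fun x ↦ eventually_enorm_mfderiv_apply_le hf x
  obtain ⟨t, -, ht⟩ := isCompact_univ.elim_nhds_subcover _ fun x _ ↦ hC x
  refine ⟨∑ x ∈ t, C x + 1, by positivity, fun y v ↦ ?_⟩
  obtain ⟨x, hx, hy⟩ := mem_iUnion₂.1 (ht (mem_univ y))
  refine (hy v).trans (mul_le_mul' ?_ le_rfl)
  have : C x ≤ ∑ x ∈ t, C x + 1 :=
    (Finset.single_le_sum (fun _ _ ↦ zero_le) hx).trans (le_add_of_nonneg_right zero_le_one)
  exact_mod_cast this

/-- A `C^1` function on a compact manifold is Lipschitz: it is so on every component, hence locally,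
hence globally by compactness. -/
theorem IsRiemannianMetric.exists_lipschitzWith [CompactSpace M] (hρ : IsRiemannianMetric d M)
    {f : M → ℝ} (hf : ContMDiff (𝓡 d) 𝓘(ℝ, ℝ) 1 f) : ∃ C : ℝ≥0, LipschitzWith C f := by
  have : LocallyConnectedSpace M :=
    ChartedSpace.locallyConnectedSpace (EuclideanSpace ℝ (Fin d)) M
  obtain ⟨C, hC0, hC⟩ := exists_enorm_mfderiv_apply_le hf
  have hloc : LocallyLipschitzOn univ f := by
    intro x _
    refine ⟨C, connectedComponent x, ?_, fun y hy z hz ↦ ?_⟩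
    · rw [nhdsWithin_univ]
      exact isOpen_connectedComponent.mem_nhds mem_connectedComponent
    · rw [hρ y z (by rwa [connectedComponent_eq hy] at hz)]
      exact edist_le_mul_riemannianEDist hf hC0 hC y z
  obtain ⟨K, hK⟩ := hloc.exists_lipschitzOnWith_of_compact isCompact_univ
  exact ⟨K, lipschitzOnWith_univ.1 hK⟩

/-- The inverse of a chart is Lipschitz near the centre of the chart: push line segments of the
model space to the manifold. -/
theorem IsRiemannianMetric.exists_lipschitzOnWith_chartAt_symm (hρ : IsRiemannianMetric d M)
    (x : M) : ∃ C : ℝ≥0, ∃ ε > 0,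
      Metric.ball (chartAt (EuclideanSpace ℝ (Fin d)) x x) ε ⊆
        (chartAt (EuclideanSpace ℝ (Fin d)) x).target ∧
      LipschitzOnWith C (chartAt (EuclideanSpace ℝ (Fin d)) x).symm
        (Metric.ball (chartAt (EuclideanSpace ℝ (Fin d)) x x) ε) := by
  obtain ⟨C, -, hC⟩ := eventually_enorm_mfderivWithin_symm_extChartAt_lt (𝓡 d) x
  rw [ModelWithCorners.range_eq_univ, nhdsWithin_univ] at hC
  obtain ⟨ε, hε, hr⟩ := Metric.mem_nhds_iff.1 (Filter.inter_mem (extChartAt_target_mem_nhds x) hC)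
  set e := extChartAt (𝓡 d) x with he
  have hcoe : ∀ y, (chartAt (EuclideanSpace ℝ (Fin d)) x).symm y = e.symm y := fun y ↦ by
    simp [he, extChartAt]
  have hcx : chartAt (EuclideanSpace ℝ (Fin d)) x x = e x := by simp [he, extChartAt]
  have htar : (chartAt (EuclideanSpace ℝ (Fin d)) x).target = e.target := by simp [he, extChartAt]
  rw [hcx, htar]
  refine ⟨C, ε, hε, fun y hy ↦ (hr hy).1, fun y hy z hz ↦ ?_⟩
  rw [hcoe, hcoe]
  have hconn : e.symm z ∈ connectedComponent (e.symm y) := by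
    have h1 : IsPreconnected (e.symm '' Metric.ball (e x) ε) :=
      (convex_ball _ _).isPreconnected.image _
        ((continuousOn_extChartAt_symm x).mono fun y hy ↦ (hr hy).1)
    exact h1.subset_connectedComponent (mem_image_of_mem _ hy) (mem_image_of_mem _ hz)
  rw [hρ _ _ hconn]
  -- `η` is the segment in the model space, `γ` the path it defines on the manifold
  let η := ContinuousAffineMap.lineMap (R := ℝ) y z
  set γ := e.symm ∘ η
  have hη : ∀ t ∈ Icc (0 : ℝ) 1, η t ∈ Metric.ball (e x) ε := by
    suffices η '' Icc 0 1 ⊆ Metric.ball (e x) ε from fun t ht ↦ this (mem_image_of_mem η ht)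
    simp only [ContinuousAffineMap.coe_lineMap_eq, ← segment_eq_image_lineMap, η]
    exact (convex_ball _ _).segment_subset hy hz
  have η_smooth : ContMDiffOn 𝓘(ℝ, ℝ) 𝓘(ℝ, EuclideanSpace ℝ (Fin d)) 1 η (Icc 0 1) := by
    apply ContMDiff.contMDiffOn
    rw [contMDiff_iff_contDiff]
    exact ContinuousAffineMap.contDiff _
  have hle : riemannianEDist (𝓡 d) (e.symm y) (e.symm z) ≤ pathELength (𝓡 d) γ 0 1 := by
    apply riemannianEDist_le_pathELength _ _ _ zero_le_one
    · exact (contMDiffOn_extChartAt_symm x).comp η_smooth fun t ht ↦ (hr (hη t ht)).1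
    · simp [γ, η, ContinuousAffineMap.coe_lineMap_eq]
    · simp [γ, η, ContinuousAffineMap.coe_lineMap_eq]
  apply hle.trans
  rw [← lintegral_fderiv_lineMap_eq_edist, pathELength_eq_lintegral_mfderivWithin_Icc,
    ← lintegral_const_mul' _ _ ENNReal.coe_ne_top]
  apply setLIntegral_mono' measurableSet_Icc (fun t ht ↦ ?_)
  have h1 : mfderivWithin 𝓘(ℝ, ℝ) (𝓡 d) γ (Icc 0 1) t =
      (mfderivWithin 𝓘(ℝ, EuclideanSpace ℝ (Fin d)) (𝓡 d) e.symm univ (η t)) ∘L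
        (mfderivWithin 𝓘(ℝ, ℝ) 𝓘(ℝ, EuclideanSpace ℝ (Fin d)) η (Icc 0 1) t) := by
    apply mfderivWithin_comp
    · have := mdifferentiableWithinAt_extChartAt_symm (I := 𝓡 d) (hr (hη t ht)).1
      rwa [ModelWithCorners.range_eq_univ] at this
    · exact η_smooth.mdifferentiableOn one_ne_zero t ht
    · exact subset_univ _
    · rw [uniqueMDiffWithinAt_iff_uniqueDiffWithinAt]
      exact uniqueDiffOn_Icc zero_lt_one t ht
  have h2 : mfderivWithin 𝓘(ℝ, ℝ) (𝓡 d) γ (Icc 0 1) t 1 =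
      (mfderivWithin 𝓘(ℝ, EuclideanSpace ℝ (Fin d)) (𝓡 d) e.symm univ (η t))
        (mfderivWithin 𝓘(ℝ, ℝ) 𝓘(ℝ, EuclideanSpace ℝ (Fin d)) η (Icc 0 1) t 1) := congr($h1 1)
  rw [h2]
  apply (ContinuousLinearMap.le_opENorm _ _).trans
  gcongr
  · exact (hr (hη t ht)).2.le
  · simp only [mfderivWithin_eq_fderivWithin]
    exact le_of_eq rfl

theorem IsRiemannianMetric.eventually_dist_le_chartAt (hρ : IsRiemannianMetric d M) (x : M) :
    ∃ C : ℝ≥0, ∀ᶠ y in 𝓝 x, dist x y ≤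
      C * ‖chartAt (EuclideanSpace ℝ (Fin d)) x y - chartAt (EuclideanSpace ℝ (Fin d)) x x‖ := by
  obtain ⟨C, ε, hε, hsub, hC⟩ := hρ.exists_lipschitzOnWith_chartAt_symm x
  set e := chartAt (EuclideanSpace ℝ (Fin d)) x
  have hx : x ∈ e.source := mem_chart_source _ x
  refine ⟨C, ?_⟩
  filter_upwards [e.open_source.mem_nhds hx,
    (e.continuousAt hx).preimage_mem_nhds (Metric.ball_mem_nhds _ hε)] with y hy hyb
  have := hC.dist_le_mul _ (Metric.mem_ball_self hε) _ hyb
  rwa [e.left_inv hx, e.left_inv hy, dist_comm (e x), dist_eq_norm (e y)] at this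

/-- The Hausdorff dimension of subsets of a `d`-dimensional manifold is at most `d`, since it is a
local notion and charts have Lipschitz inverses. -/
theorem IsRiemannianMetric.dimH_le [CompactSpace M] (hρ : IsRiemannianMetric d M) (s : Set M) :
    dimH s ≤ d := by
  by_contra! hlt
  have : SecondCountableTopology M := EMetric.secondCountable_of_sigmaCompact M
  obtain ⟨x, -, hx⟩ := exists_mem_nhdsWithin_lt_dimH_of_lt_dimH hlt
  obtain ⟨C, ε, hε, hsub, hC⟩ := hρ.exists_lipschitzOnWith_chartAt_symm x
  set e := chartAt (EuclideanSpace ℝ (Fin d)) x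
  have hxs : x ∈ e.source := mem_chart_source _ x
  have himg : e.symm '' Metric.ball (e x) ε ∈ 𝓝 x := by
    filter_upwards [e.open_source.mem_nhds hxs,
      (e.continuousAt hxs).preimage_mem_nhds (Metric.ball_mem_nhds _ hε)] with y hy hyb
    exact ⟨e y, hyb, e.left_inv hy⟩
  refine absurd (hx _ (mem_nhdsWithin_of_mem_nhds himg)) (not_lt.2 ?_)
  calc dimH (e.symm '' Metric.ball (e x) ε) ≤ dimH (Metric.ball (e x) ε) := hC.dimH_image_le
    _ ≤ dimH (univ : Set (EuclideanSpace ℝ (Fin d))) := dimH_mono (subset_univ _)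
    _ = d := by rw [Real.dimH_univ_eq_finrank, finrank_euclideanSpace_fin]

end RiemannianDistance

/-! ### Interpolation of first order jets by finitely many observables -/

section Interpolation

theorem ENat.coe_ne_zero_of_one_le {r : ℕ∞} (hr : 1 ≤ r) : (r : ℕ∞ω) ≠ 0 := by
  rintro h
  simp_all

variable {d : ℕ} {r : ℕ∞} {M : Type*} [TopologicalSpace M]
  [ChartedSpace (EuclideanSpace ℝ (Fin d)) M]

theorem Observable.mdifferentiableAt (hr : 1 ≤ r) (f : Observable d r M) (p : M) :
    MDifferentiableAt (𝓡 d) 𝓘(ℝ, ℝ) f p :=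
  f.contMDiff.mdifferentiable (ENat.coe_ne_zero_of_one_le hr) p

theorem hasMFDerivAt_zero_of_apply_eq_zero {f : M → ℝ} {p : M}
    {L : EuclideanSpace ℝ (Fin d) →L[ℝ] ℝ} (h : HasMFDerivAt (𝓡 d) 𝓘(ℝ, ℝ) f p L)
    (hL : ∀ v, L v = 0) :
    HasMFDerivAt (𝓡 d) 𝓘(ℝ, ℝ) f p (0 : EuclideanSpace ℝ (Fin d) →L[ℝ] ℝ) := by
  have : L = 0 := ContinuousLinearMap.ext hL
  rwa [this] at h

/-- The ideal of the observables whose value and differential vanish at `p`. Two observables are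
congruent modulo this ideal when they have the same first order jet at `p`. -/
def flatIdeal (hr : 1 ≤ r) (p : M) : Ideal (Observable d r M) where
  carrier := {f | f p = 0 ∧ HasMFDerivAt (𝓡 d) 𝓘(ℝ, ℝ) f p
    (0 : EuclideanSpace ℝ (Fin d) →L[ℝ] ℝ)}
  add_mem' := by
    rintro f g ⟨hf, hf'⟩ ⟨hg, hg'⟩
    refine ⟨by simp [hf, hg], ?_⟩
    exact hasMFDerivAt_zero_of_apply_eq_zero (hf'.add hg') fun v ↦ add_zero (0 : ℝ)
  zero_mem' := ⟨rfl, hasMFDerivAt_const (0 : ℝ) p⟩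
  smul_mem' := by
    rintro c f ⟨hf, hf'⟩
    refine ⟨by simp [hf], ?_⟩
    refine hasMFDerivAt_zero_of_apply_eq_zero
      ((c.mdifferentiableAt hr p).hasMFDerivAt.mul hf') fun v ↦ ?_
    change c p * (0 : ℝ) + f p * (_ : ℝ) = 0
    rw [hf, mul_zero, zero_mul, add_zero]

/-- By the product rule, a product of two functions vanishing at `p` is flat at `p`. -/
theorem mul_mem_flatIdeal (hr : 1 ≤ r) {p : M} {f g : Observable d r M} (hf : f p = 0)
    (hg : g p = 0) : f * g ∈ flatIdeal hr p := by
  refine ⟨by simp [hf], ?_⟩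
  refine hasMFDerivAt_zero_of_apply_eq_zero ((f.mdifferentiableAt hr p).hasMFDerivAt.mul
    (g.mdifferentiableAt hr p).hasMFDerivAt) fun v ↦ ?_
  change f p * (_ : ℝ) + g p * (_ : ℝ) = 0
  rw [hf, hg, zero_mul, zero_mul, add_zero]

theorem apply_eq_of_sub_mem_flatIdeal {hr : 1 ≤ r} {p : M} {f g : Observable d r M}
    (h : f - g ∈ flatIdeal hr p) : f p = g p :=
  sub_eq_zero.1 h.1

theorem Submodule.prod_mem_pow_card {R A ι : Type*} [CommSemiring R] [CommSemiring A] [Algebra R A]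
    (V : Submodule R A) (s : Finset ι) {f : ι → A} (hf : ∀ i ∈ s, f i ∈ V) :
    ∏ i ∈ s, f i ∈ V ^ s.card := by
  classical
  induction s using Finset.induction_on with
  | empty => rw [Finset.prod_empty, Finset.card_empty, pow_zero]; exact Submodule.one_le.1 le_rfl
  | insert i s hi ih =>
    rw [Finset.prod_insert hi, Finset.card_insert_of_notMem hi, pow_succ']
    exact Submodule.mul_mem_mul (hf i (by simp)) (ih fun j hj ↦ hf j (by simp [hj]))

theorem Submodule.pow_le_pow_of_one_le {R A : Type*} [CommSemiring R] [CommSemiring A] [Algebra R A]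
    {V : Submodule R A} (hV : 1 ≤ V) {m n : ℕ} (h : m ≤ n) : V ^ m ≤ V ^ n := by
  induction n, h using Nat.le_induction with
  | base => exact le_rfl
  | succ n _ ih =>
    rw [pow_succ]
    exact ih.trans ((mul_one (V ^ n)).symm.le.trans (mul_le_mul_right hV _))

theorem Submodule.mul_mul_mem_pow {R A : Type*} [CommSemiring R] [CommSemiring A] [Algebra R A]
    {V : Submodule R A} {N : ℕ} {f g : A} (hf : f ∈ V ^ N) (hg : g ∈ V) :
    f * f * g ∈ V ^ (N + N + 1) := by
  rw [pow_succ, _root_.pow_add]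
  exact Submodule.mul_mem_mul (Submodule.mul_mem_mul hf hf) hg

/-- Hermite interpolation: if a space `A` of observables separates points and realizes all first
order jets, its powers contain solutions of the interpolation problems for first order jets at
finitely many points. A product of functions of `A` that separate `p` from the other points has
a square with the value `1` at `p` and zero jets at the other points, which localizes the problem
at `p`. -/
theorem exists_mem_pow_sub_mem_flatIdeal (hr : 1 ≤ r) {A : Submodule ℝ (Observable d r M)}
    (h1 : 1 ∈ A) (hsep : ∀ p q : M, p ≠ q → ∃ a ∈ A, a p = 1 ∧ a q = 0)
    (hjet : ∀ (p : M) (g : Observable d r M), ∃ a ∈ A, a - g ∈ flatIdeal hr p)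
    (S : Finset M) {N : ℕ} (hN : S.card ≤ N) (g : M → Observable d r M) :
    ∃ h ∈ A ^ (N + N + 1), ∀ p ∈ S, h - g p ∈ flatIdeal hr p := by
  classical
  have hA : (1 : Submodule ℝ (Observable d r M)) ≤ A := Submodule.one_le.2 h1
  have key : ∀ p ∈ S, ∃ h ∈ A ^ (N + N + 1), h - g p ∈ flatIdeal hr p ∧
      ∀ q ∈ S, q ≠ p → h ∈ flatIdeal hr q := by
    intro p hp
    choose! a haA hap haq using fun q ↦ hsep p q
    set P := ∏ q ∈ S.erase p, a q with hP
    have hPA : P ∈ A ^ N :=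
      Submodule.pow_le_pow_of_one_le hA ((Finset.card_le_card (Finset.erase_subset p S)).trans hN)
        (A.prod_mem_pow_card _ fun q hq ↦ haA q (Finset.ne_of_mem_erase hq).symm)
    have hev : ∀ x, P x = ∏ q ∈ S.erase p, a q x := fun x ↦
      map_prod (ContMDiffMap.evalRingHom (I := 𝓡 d) (n := r) (R := ℝ) (N := M) x) _ _
    have hPp : P p = 1 := by
      rw [hev]
      exact Finset.prod_eq_one fun q hq ↦ hap q (Finset.ne_of_mem_erase hq).symm
    have hPq : ∀ q ∈ S, q ≠ p → P q = 0 := by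
      intro q hq hqp
      rw [hev]
      exact Finset.prod_eq_zero (Finset.mem_erase.2 ⟨hqp, hq⟩) (haq q hqp.symm)
    -- `b` corrects the first order jet of `P * P` at `p`
    set c : Observable d r M := algebraMap ℝ _ (g p p) with hc
    have hcp : ∀ x, c x = g p p := fun x ↦ rfl
    obtain ⟨b, hbA, hb⟩ := hjet p (g p - c * (P * P - 1))
    refine ⟨P * P * b, ?_, ?_, ?_⟩
    · exact Submodule.mul_mul_mem_pow hPA hbA
    · have e1 : P * P * b - g p = P * P * (b - (g p - c * (P * P - 1))) +
          ((P * P - 1) * (g p - c) - c * ((P * P - 1) * (P * P - 1))) := by ring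
      rw [e1]
      refine Ideal.add_mem _ (Ideal.mul_mem_left _ _ hb) (Ideal.sub_mem _ ?_ ?_)
      · exact mul_mem_flatIdeal hr (by simp [hPp]) (by simp [hcp])
      · exact Ideal.mul_mem_left _ _ (mul_mem_flatIdeal hr (by simp [hPp]) (by simp [hPp]))
    · intro q hq hqp
      exact Ideal.mul_mem_right _ _ (mul_mem_flatIdeal hr (hPq q hq hqp) (hPq q hq hqp))
  choose! h hhA hhp hhq using key
  refine ⟨∑ p ∈ S, h p, Submodule.sum_mem _ hhA, fun p hp ↦ ?_⟩
  rw [← Finset.add_sum_erase _ _ hp, add_sub_right_comm]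
  refine Ideal.add_mem _ (hhp p hp) (Ideal.sum_mem _ fun q hq ↦ ?_)
  exact hhq q (Finset.mem_of_mem_erase hq) p hp (Finset.ne_of_mem_erase hq).symm

variable [IsManifold (𝓡 d) r M]

/-- If observables `c i` agree near `p` with the coordinates of a chart, every observable is
congruent to an affine combination of the `c i` up to first order at `p`. -/
theorem sub_mem_flatIdeal_of_coordinates (hr : 1 ≤ r)
    {e : OpenPartialHomeomorph M (EuclideanSpace ℝ (Fin d))}
    (he : e ∈ atlas (EuclideanSpace ℝ (Fin d)) M) {p : M} (hp : p ∈ e.source)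
    {c : Fin d → Observable d r M} (hc : ∀ᶠ y in 𝓝 p, ∀ i, c i y = e y i)
    (g : Observable d r M) :
    ∃ (a₀ : ℝ) (a : Fin d → ℝ), a₀ • (1 : Observable d r M) + ∑ i, a i • c i - g ∈
      flatIdeal hr p := by
  have hr0 : (r : ℕ∞ω) ≠ 0 := ENat.coe_ne_zero_of_one_le hr
  set G := fderiv ℝ (g ∘ e.symm) (e p)
  have hG : HasFDerivAt (g ∘ e.symm) G (e p) :=
    ((g.contDiffAt_comp_symm he (e.map_source hp)).differentiableAt hr0).hasFDerivAt
  set a : Fin d → ℝ := fun i ↦ G (EuclideanSpace.single i 1)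
  have hGa : ∀ z : EuclideanSpace ℝ (Fin d), ∑ i, a i * z i = G z := by
    intro z
    conv_rhs => rw [← (EuclideanSpace.basisFun (Fin d) ℝ).sum_repr z, map_sum]
    refine Finset.sum_congr rfl fun i _ ↦ ?_
    rw [map_smul, smul_eq_mul, mul_comm]
    simp [a]
  have hev : ∀ (a₀ : ℝ) (y : M), (a₀ • (1 : Observable d r M) + ∑ i, a i • c i - g) y =
      a₀ + ∑ i, a i * c i y - g y := by
    intro a₀ y
    have := congrFun (map_sum (ContMDiffMap.coeFnLinearMap (𝕜 := ℝ) (I := 𝓡 d) (N := M)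
        (V := ℝ) (n := r)) (fun i ↦ a i • c i) Finset.univ) y
    simp only [ContMDiffMap.coe_sub, ContMDiffMap.coe_add, Pi.sub_apply, Pi.add_apply]
    congr 2
    · simp
    · simpa using this
  refine ⟨g p - G (e p), a, ?_, ?_⟩
  · rw [hev]
    simp only [hc.self_of_nhds, hGa]
    ring
  · have h1 : HasFDerivAt (fun z ↦ (g p - G (e p)) + G z - (g ∘ e.symm) z)
        (0 : EuclideanSpace ℝ (Fin d) →L[ℝ] ℝ) (e p) := by
      have := (G.hasFDerivAt.const_add (g p - G (e p)) (x := e p)).sub hG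
      rwa [sub_self] at this
    have h2 : MDifferentiableAt (𝓡 d) (𝓡 d) e p :=
      (contMDiffAt_of_mem_maximalAtlas (I := 𝓡 d) (n := r)
        (IsManifold.subset_maximalAtlas he) hp).mdifferentiableAt hr0
    have h3 := h1.hasMFDerivAt.comp p h2.hasMFDerivAt
    have h4 := h3.congr_of_eventuallyEq (f₁ := (g p - G (e p)) • (1 : Observable d r M)
      + ∑ i, a i • c i - g) (by
        filter_upwards [hc, e.open_source.mem_nhds hp] with y hy hys
        rw [hev]
        simp [hy, hGa, e.left_inv hys])
    exact hasMFDerivAt_zero_of_apply_eq_zero h4 fun v ↦ rfl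

variable [T2Space M]

theorem SmoothBumpFunction.contMDiff_mul_of_contDiff {q : M} (f : SmoothBumpFunction (𝓡 d) q)
    {G : EuclideanSpace ℝ (Fin d) → ℝ} (hG : ContDiff ℝ r G) :
    ContMDiff (𝓡 d) 𝓘(ℝ, ℝ) r
      fun x ↦ f x * G (chartAt (EuclideanSpace ℝ (Fin d)) q x) := by
  refine contMDiff_of_tsupport fun x hx ↦ ?_
  have hxs : x ∈ (chartAt (EuclideanSpace ℝ (Fin d)) q).source :=
    f.tsupport_subset_chartAt_source (tsupport_mul_subset_left hx)
  have hchart : ContMDiffAt (𝓡 d) (𝓡 d) r (chartAt (EuclideanSpace ℝ (Fin d)) q) x :=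
    contMDiffAt_of_mem_maximalAtlas (IsManifold.chart_mem_maximalAtlas q) hxs
  have hf : ContMDiffAt (𝓡 d) 𝓘(ℝ, ℝ) r f x := by
    refine ContMDiffAt.congr_of_eventuallyEq ?_ (f.eqOn_source.eventuallyEq_of_mem
      ((chartAt _ q).open_source.mem_nhds hxs))
    exact f.contDiffAt.contMDiffAt.comp x (contMDiffAt_extChartAt' hxs)
  exact hf.mul (hG.contDiffAt.contMDiffAt.comp x hchart)

/-- A bump function `ψ` around `q` and the coordinate functions of the chart at `q` multiplied
by `ψ`. -/
theorem exists_bump_coordinates (q : M) :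
    ∃ (ψ : Observable d r M) (c : Fin d → Observable d r M), (∀ᶠ y in 𝓝 q, ψ y = 1) ∧
      ∀ y, ψ y = 1 → y ∈ (chartAt (EuclideanSpace ℝ (Fin d)) q).source ∧
        ∀ i, c i y = chartAt (EuclideanSpace ℝ (Fin d)) q y i := by
  obtain ⟨f⟩ : Nonempty (SmoothBumpFunction (𝓡 d) q) := inferInstance
  refine ⟨⟨fun x ↦ f x * 1, f.contMDiff_mul_of_contDiff (G := fun _ ↦ 1) contDiff_const⟩,
    fun i ↦ ⟨fun x ↦ f x * chartAt (EuclideanSpace ℝ (Fin d)) q x i,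
      f.contMDiff_mul_of_contDiff (G := fun z ↦ z i) (by fun_prop)⟩, ?_, ?_⟩
  · filter_upwards [f.eventuallyEq_one] with y hy
    simp [hy]
  · intro y hy
    have hy1 : f y = 1 := by simpa using hy
    refine ⟨?_, fun i ↦ by simp [hy1]⟩
    have : y ∈ support f := by simp [hy1]
    rw [f.support_eq_inter_preimage] at this
    exact this.1

/-- The bump functions and cut-off coordinates of finitely many charts span, with the constants,
a space that separates points and realizes all first order jets. -/
theorem exists_fg_separating_jets [CompactSpace M] (hr : 1 ≤ r) :
    ∃ A : Submodule ℝ (Observable d r M), A.FG ∧ 1 ∈ A ∧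
      (∀ p q : M, p ≠ q → ∃ a ∈ A, a p = 1 ∧ a q = 0) ∧
      ∀ (p : M) (g : Observable d r M), ∃ a ∈ A, a - g ∈ flatIdeal hr p := by
  choose ψ c hψ hc using fun q : M ↦ exists_bump_coordinates (d := d) (r := r) q
  obtain ⟨t, -, ht⟩ := isCompact_univ.elim_nhds_subcover
    (fun q ↦ {y | ∀ᶠ z in 𝓝 y, ψ q z = 1}) fun q _ ↦ eventually_eventually_nhds.2 (hψ q)
  set B : Set (Observable d r M) := {1} ∪ ⋃ q ∈ t, ({ψ q} ∪ range (c q)) with hB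
  have h1 : (1 : Observable d r M) ∈ Submodule.span ℝ B :=
    Submodule.subset_span (Or.inl rfl)
  have hψA : ∀ q ∈ t, ψ q ∈ Submodule.span ℝ B := fun q hq ↦
    Submodule.subset_span (Or.inr (mem_biUnion hq (Or.inl rfl)))
  have hcA : ∀ q ∈ t, ∀ i, c q i ∈ Submodule.span ℝ B := fun q hq i ↦
    Submodule.subset_span (Or.inr (mem_biUnion hq (Or.inr (mem_range_self i))))
  -- an element of the span taking different values at `p` and `q` can be normalized
  have hnorm : ∀ p q : M, ∀ f ∈ Submodule.span ℝ B, f p ≠ f q →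
      ∃ a ∈ Submodule.span ℝ B, a p = 1 ∧ a q = 0 := by
    intro p q f hf hpq
    refine ⟨(f p - f q)⁻¹ • (f - f q • 1), Submodule.smul_mem _ _
      (Submodule.sub_mem _ hf (Submodule.smul_mem _ _ h1)), ?_, ?_⟩
    · simp [inv_mul_cancel₀ (sub_ne_zero.2 hpq)]
    · simp
  refine ⟨Submodule.span ℝ B, Submodule.fg_span ?_, h1, fun p q hpq ↦ ?_, fun p g ↦ ?_⟩
  · exact (finite_singleton _).union
      (t.finite_toSet.biUnion fun q _ ↦ (finite_singleton _).union (finite_range _))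
  · obtain ⟨x, hx, hpx⟩ := mem_iUnion₂.1 (ht (mem_univ p))
    have hp1 : ψ x p = 1 := Filter.Eventually.self_of_nhds (p := fun z ↦ ψ x z = 1) hpx
    by_cases hq1 : ψ x q = 1
    · obtain ⟨hps, hpc⟩ := hc x p hp1
      obtain ⟨hqs, hqc⟩ := hc x q hq1
      have hne : chartAt (EuclideanSpace ℝ (Fin d)) x p ≠ chartAt (EuclideanSpace ℝ (Fin d)) x q :=
        fun h ↦ hpq ((chartAt (EuclideanSpace ℝ (Fin d)) x).injOn hps hqs h)
      obtain ⟨i, hi⟩ : ∃ i, chartAt (EuclideanSpace ℝ (Fin d)) x p i ≠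
          chartAt (EuclideanSpace ℝ (Fin d)) x q i := by
        by_contra! h
        exact hne (PiLp.ext h)
      exact hnorm p q (c x i) (hcA x hx i) (by rwa [hpc, hqc])
    · exact hnorm p q (ψ x) (hψA x hx) (by rw [hp1]; exact Ne.symm hq1)
  · obtain ⟨x, hx, hpx⟩ := mem_iUnion₂.1 (ht (mem_univ p))
    have hp1 : ψ x p = 1 := Filter.Eventually.self_of_nhds (p := fun z ↦ ψ x z = 1) hpx
    obtain ⟨a₀, a, ha⟩ := sub_mem_flatIdeal_of_coordinates hr
      (chart_mem_atlas (EuclideanSpace ℝ (Fin d)) x) (hc x p hp1).1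
      (Filter.Eventually.mono hpx fun y hy ↦ (hc x y hy).2) g
    exact ⟨_, Submodule.add_mem _ (Submodule.smul_mem _ _ h1)
      (Submodule.sum_mem _ fun i _ ↦ Submodule.smul_mem _ _ (hcA x hx i)), ha⟩

/-- A finite family of observables is `N`-interpolating if its linear span contains solutions of all
interpolation problems for first order jets at at most `N` points. -/
def IsInterpolating {d : ℕ} {r : ℕ∞} {M : Type*} [TopologicalSpace M]
    [ChartedSpace (EuclideanSpace ℝ (Fin d)) M] (hr : 1 ≤ r) (N : ℕ) {m : ℕ}
    (b : Fin m → Observable d r M) : Prop :=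
  ∀ S : Finset M, S.card ≤ N → ∀ g : M → Observable d r M, ∃ a : Fin m → ℝ,
    ∀ p ∈ S, ∑ j, a j • b j - g p ∈ flatIdeal hr p

theorem exists_interpolating_family [CompactSpace M] (hr : 1 ≤ r) (N : ℕ) :
    ∃ (m : ℕ) (b : Fin m → Observable d r M), IsInterpolating hr N b := by
  obtain ⟨A, hfg, h1, hsep, hjet⟩ := exists_fg_separating_jets (d := d) (M := M) hr
  obtain ⟨m, b, hb⟩ := Submodule.fg_iff_exists_fin_generating_family.1 (hfg.pow (N + N + 1))
  refine ⟨m, b, fun S hS g ↦ ?_⟩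
  obtain ⟨h, hA, hh⟩ := exists_mem_pow_sub_mem_flatIdeal hr h1 hsep hjet S hS g
  rw [← hb] at hA
  obtain ⟨a, rfl⟩ := (Submodule.mem_span_range_iff_exists_fun ℝ).1 hA
  exact ⟨a, hh⟩

end Interpolation

/-! ### Null sets of parameters -/

section NullSets

open scoped NNReal

/-- If `N` has Hausdorff dimension less than `k` and the affine equations `c y + L y s = 0` in
`s ∈ ℝ^k` depend on `y ∈ N` in a Lipschitz way and are uniformly nondegenerate, the set of all their
solutions is null: among the solutions of norm at most `R`, the solution is a Lipschitz function of
the parameter. -/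
theorem volume_setOf_exists_add_apply_eq_zero {M : Type*} [MetricSpace M] {k : ℕ} {N : Set M}
    (hN : dimH N < k) {c : M → EuclideanSpace ℝ (Fin k)}
    {L : M → EuclideanSpace ℝ (Fin k) →ₗ[ℝ] EuclideanSpace ℝ (Fin k)} {K₁ K₂ : ℝ≥0}
    (hc : ∀ y ∈ N, ∀ z ∈ N, ‖c y - c z‖ ≤ K₁ * dist y z)
    (hL : ∀ y ∈ N, ∀ s, ‖s‖ ≤ 2 * ‖L y s‖)
    (hLip : ∀ y ∈ N, ∀ z ∈ N, ∀ s, ‖L y s - L z s‖ ≤ K₂ * ‖s‖ * dist y z) :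
    volume {s | ∃ y ∈ N, c y + L y s = 0} = 0 := by
  have hunion : {s | ∃ y ∈ N, c y + L y s = 0} ⊆
      ⋃ R : ℕ, {s | ‖s‖ ≤ R ∧ ∃ y ∈ N, c y + L y s = 0} := by
    intro s hs
    obtain ⟨R, hR⟩ := exists_nat_ge ‖s‖
    exact mem_iUnion.2 ⟨R, hR, hs⟩
  refine measure_mono_null hunion (measure_iUnion_null fun R ↦ ?_)
  set A := {s : EuclideanSpace ℝ (Fin k) | ‖s‖ ≤ R ∧ ∃ y ∈ N, c y + L y s = 0}
  choose f hfN hf using fun s : A ↦ s.2.2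
  -- `f` chooses a parameter for each solution; subtracting the equations of two solutions bounds
  -- their distance by that of the parameters
  have hanti : AntilipschitzWith (2 * (K₁ + K₂ * R)) f := by
    refine AntilipschitzWith.of_le_mul_dist fun s t ↦ ?_
    have h1 : L (f s) (s.1 - t.1) = (c (f t) - c (f s)) + (L (f t) t - L (f s) t) := by
      rw [map_sub, eq_neg_of_add_eq_zero_right (hf s), ← sub_eq_zero]
      calc _ = -(c (f t) + L (f t) t) := by abel
        _ = 0 := by rw [hf t, neg_zero]
    have h4 := hc _ (hfN t) _ (hfN s)
    have h5 := hLip _ (hfN t) _ (hfN s) t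
    have h6 : (K₂ : ℝ) * ‖t.1‖ * dist (f t) (f s) ≤ K₂ * R * dist (f t) (f s) := by
      have := t.2.1
      gcongr
    calc dist s t = ‖s.1 - t.1‖ := by rw [Subtype.dist_eq, dist_eq_norm]
      _ ≤ 2 * ‖L (f s) (s.1 - t.1)‖ := hL _ (hfN s) _
      _ ≤ 2 * (K₁ * dist (f t) (f s) + K₂ * R * dist (f t) (f s)) := by
        rw [h1]
        have := norm_add_le (c (f t) - c (f s)) (L (f t) t - L (f s) t)
        linarith
      _ = ((2 * (K₁ + K₂ * R) : ℝ≥0) : ℝ) * dist (f s) (f t) := by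
        rw [dist_comm (f t)]
        push_cast
        ring
  have hdim : dimH A < k := by
    have h1 : dimH (univ : Set A) ≤ dimH (f '' univ) := hanti.le_dimH_image _
    have h2 : dimH (univ : Set A) = dimH A := by
      rw [← (isometry_subtype_coe (s := A)).dimH_image, image_univ, Subtype.range_coe]
    rw [← h2]
    refine (h1.trans (dimH_mono ?_)).trans_lt hN
    rintro _ ⟨s, -, rfl⟩
    exact hfN s
  have hac : (volume : Measure (EuclideanSpace ℝ (Fin k))) ≪ μH[(k : ℝ≥0)] := by
    have := (isAddHaarMeasure_hausdorffMeasure (E := EuclideanSpace ℝ (Fin k)))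
    rw [finrank_euclideanSpace_fin, ← NNReal.coe_natCast] at this
    exact Measure.absolutelyContinuous_isAddHaarMeasure _ _
  exact measure_zero_of_dimH_lt hac (by simpa using hdim)

/-- The matrices `B + t J` are injective for all but finitely many `t`, if `J` is injective: `-t`
has to avoid the eigenvalues of `P B`, where `P` is a left inverse of `J`. -/
theorem ae_injective_add_smul {d k : ℕ}
    (B J : EuclideanSpace ℝ (Fin d) →L[ℝ] EuclideanSpace ℝ (Fin k))
    (P : EuclideanSpace ℝ (Fin k) →ₗ[ℝ] EuclideanSpace ℝ (Fin d)) (hPJ : ∀ u, P (J u) = u) :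
    ∀ᵐ t : ℝ, Injective (B + t • J) := by
  set Q : Module.End ℝ (EuclideanSpace ℝ (Fin d)) := P ∘ₗ B.toLinearMap
  have hfin : {t : ℝ | Q.HasEigenvalue (-t)}.Finite :=
    Q.finite_hasEigenvalue.preimage neg_injective.injOn
  filter_upwards [compl_mem_ae_iff.2 (hfin.measure_zero volume)] with t ht
  rw [injective_iff_map_eq_zero]
  intro u hu
  by_contra hu0
  refine ht (Module.End.hasEigenvalue_of_hasEigenvector (x := u)
    ⟨Module.End.mem_eigenspace_iff.2 ?_, hu0⟩)
  have h1 : B u = -(t • J u) := eq_neg_of_add_eq_zero_left hu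
  change P (B u) = -t • u
  rw [h1, map_neg, map_smul, hPJ, neg_smul]

/-- A function with injective derivative is bounded below by a multiple of the distance. -/
theorem HasFDerivAt.exists_eventually_norm_sub_le {d : ℕ} {F : Type*} [NormedAddCommGroup F]
    [NormedSpace ℝ F] {f : EuclideanSpace ℝ (Fin d) → F} {f' : EuclideanSpace ℝ (Fin d) →L[ℝ] F}
    {z₀ : EuclideanSpace ℝ (Fin d)} (hf : HasFDerivAt f f' z₀) (hinj : Injective f') :
    ∃ C : ℝ≥0, ∀ᶠ z in 𝓝 z₀, ‖z - z₀‖ ≤ C * ‖f z - f z₀‖ := by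
  obtain ⟨K, hK0, hK⟩ := f'.injective_iff_antilipschitz.1 hinj
  have hK0' : (0 : ℝ) < K := hK0
  refine ⟨2 * K, ?_⟩
  have ho := (hasFDerivAt_iff_isLittleO.1 hf).def (c := (2 * K : ℝ)⁻¹) (by positivity)
  filter_upwards [ho] with z hz
  have h1 : ‖z - z₀‖ ≤ K * ‖f' (z - z₀)‖ := ZeroHomClass.bound_of_antilipschitz f' hK _
  have h2 : ‖f' (z - z₀)‖ ≤ ‖f z - f z₀‖ + (2 * K : ℝ)⁻¹ * ‖z - z₀‖ := by
    have := norm_sub_le (f z - f z₀) (f z - f z₀ - f' (z - z₀))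
    rw [sub_sub_cancel] at this
    linarith
  have h3 : (K : ℝ) * ((2 * K : ℝ)⁻¹ * ‖z - z₀‖) = ‖z - z₀‖ / 2 := by
    field_simp
  have h4 := h1.trans (mul_le_mul_of_nonneg_left h2 hK0'.le)
  rw [mul_add, h3] at h4
  push_cast
  linarith

end NullSets

/-! ### Injectivity of the delay coordinate map at a point -/

section Delay

open scoped NNReal

section Basic

variable {d : ℕ} {r : ℕ∞} {M : Type*} [TopologicalSpace M]
  [ChartedSpace (EuclideanSpace ℝ (Fin d)) M] {T : M → M}

theorem ContMDiff.iterate_self (hT : ContMDiff (𝓡 d) (𝓡 d) r T) (i : ℕ) :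
    ContMDiff (𝓡 d) (𝓡 d) r T^[i] := by
  induction i with
  | zero => exact contMDiff_id
  | succ i ih => rw [iterate_succ]; exact ih.comp hT

/-- The delay coordinates at a point, as a linear function of the observable. -/
noncomputable def delayLinearMap (d : ℕ) (r : ℕ∞) [ChartedSpace (EuclideanSpace ℝ (Fin d)) M]
    (T : M → M) (k : ℕ) (x : M) : Observable d r M →ₗ[ℝ] EuclideanSpace ℝ (Fin k) where
  toFun f := delayMap T f k x
  map_add' _ _ := rfl
  map_smul' _ _ := rfl

theorem delayMap_add_sum {m : ℕ} (b : Fin m → Observable d r M) (v : Observable d r M)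
    (a : Fin m → ℝ) (k : ℕ) (x : M) :
    delayMap T ⇑(v + ∑ j, a j • b j) k x = delayMap T v k x + ∑ j, a j • delayMap T (b j) k x := by
  have := map_add (delayLinearMap d r T k x) v (∑ j, a j • b j)
  rw [map_sum] at this
  exact this

theorem delayMap_add_sum_add {m : ℕ} (b : Fin m → Observable d r M) (v : Observable d r M)
    (a a' : Fin m → ℝ) (k : ℕ) (x : M) :
    delayMap T ⇑(v + ∑ j, (a + a') j • b j) k x =
      delayMap T ⇑(v + ∑ j, a j • b j) k x + delayMap T ⇑(∑ j, a' j • b j) k x := by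
  have h1 : v + ∑ j, (a + a') j • b j = (v + ∑ j, a j • b j) + ∑ j, a' j • b j := by
    simp only [Pi.add_apply, add_smul, Finset.sum_add_distrib, add_assoc]
  rw [h1]
  exact map_add (delayLinearMap d r T k x) _ _

theorem continuous_delayMap (hT : Continuous T) (k : ℕ) :
    Continuous fun p : M × Observable d r M ↦ delayMap T p.2 k p.1 := by
  refine (PiLp.continuous_toLp 2 _).comp (continuous_pi fun i ↦ ?_)
  exact Observable.continuous_eval.comp
    (((hT.iterate i).comp continuous_fst).prodMk continuous_snd)

variable [IsManifold (𝓡 d) r M]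

theorem continuous_affine_family {m : ℕ} (b : Fin m → Observable d r M) (v : Observable d r M) :
    Continuous fun a : Fin m → ℝ ↦ v + ∑ j, a j • b j :=
  (Observable.continuous_const_add v).comp (Observable.continuous_linearCombination b)

/-- The complement is the projection of a closed set along the compact factor `Y`. -/
theorem isOpen_setOf_forall_delayMap_ne (hT : Continuous T) {m : ℕ} (b : Fin m → Observable d r M)
    (v : Observable d r M) (k : ℕ) (x : M) {Y : Set M} (hY : IsCompact Y) :
    IsOpen {a : Fin m → ℝ | ∀ y ∈ Y,
      delayMap T ⇑(v + ∑ j, a j • b j) k y ≠ delayMap T ⇑(v + ∑ j, a j • b j) k x} := by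
  have : CompactSpace Y := isCompact_iff_compactSpace.1 hY
  have hc1 : Continuous fun p : (Fin m → ℝ) × Y ↦ delayMap T ⇑(v + ∑ j, p.1 j • b j) k p.2 :=
    (continuous_delayMap hT k).comp ((continuous_subtype_val.comp continuous_snd).prodMk
      ((continuous_affine_family b v).comp continuous_fst))
  have hc2 : Continuous fun p : (Fin m → ℝ) × Y ↦ delayMap T ⇑(v + ∑ j, p.1 j • b j) k x :=
    (continuous_delayMap hT k).comp (continuous_const.prodMk
      ((continuous_affine_family b v).comp continuous_fst))
  have hcl := isClosedMap_fst_of_compactSpace (X := Fin m → ℝ) (Y := Y) _ (isClosed_eq hc1 hc2)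
  rw [← isOpen_compl_iff] at hcl
  convert hcl using 1
  ext a
  simp

end Basic

variable {d : ℕ} {r : ℕ∞} {M : Type*} [MetricSpace M] [CompactSpace M]
  [ChartedSpace (EuclideanSpace ℝ (Fin d)) M]
  [IsManifold (𝓡 d) 1 M]
  [RiemannianBundle (fun x : M ↦ TangentSpace (𝓡 d) x)]
  [IsContinuousRiemannianBundle (EuclideanSpace ℝ (Fin d)) (fun x : M ↦ TangentSpace (𝓡 d) x)]
  {T : M → M}

theorem exists_lipschitzWith_delayMap (hρ : IsRiemannianMetric d M) (hr : 1 ≤ r)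
    (hT : ContMDiff (𝓡 d) (𝓡 d) r T) (f : Observable d r M) (k : ℕ) :
    ∃ K : ℝ≥0, LipschitzWith K (delayMap T f k) := by
  have h1 : ∀ i : Fin k, ∃ K : ℝ≥0, LipschitzWith K (f ∘ T^[i]) := fun i ↦
    hρ.exists_lipschitzWith ((f.contMDiff.comp (hT.iterate_self i)).of_le (by exact_mod_cast hr))
  choose K hK using h1
  have h2 : LipschitzWith (∑ i, K i) fun x ↦ fun i : Fin k ↦ f (T^[i] x) := by
    refine LipschitzWith.of_dist_le_mul fun x y ↦ (dist_pi_le_iff (by positivity)).2 fun i ↦ ?_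
    refine ((hK i).dist_le_mul x y).trans ?_
    gcongr
    exact Finset.single_le_sum (f := K) (fun _ _ ↦ zero_le) (Finset.mem_univ i)
  exact ⟨_, ((PiLp.lipschitzWith_toLp 2 fun _ : Fin k ↦ ℝ).comp h2)⟩

variable [IsManifold (𝓡 d) r M]

/-- Points `y` whose delay orbit avoids that of `x` are locally separated from `x` by almost every
observable: there the delay coordinates can be prescribed at `x` without changing them at `y`, which
allows to apply `volume_setOf_exists_add_apply_eq_zero` on `k`-dimensional affine subspaces. -/
theorem exists_nhds_ae_delayMap_ne (hρ : IsRiemannianMetric d M) (hr : 1 ≤ r)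
    (hT : ContMDiff (𝓡 d) (𝓡 d) r T) {k m : ℕ} {b : Fin m → Observable d r M}
    (hb : IsInterpolating hr (k + k) b) (v : Observable d r M) {x y₀ : M}
    (hx : Injective fun i : Fin k ↦ T^[i] x)
    (hxy : ∀ i j : Fin k, T^[i] y₀ ≠ T^[j] x) {Y : Set M} (hY : IsCompact Y) (hdim : dimH Y < k) :
    ∃ N ∈ 𝓝 y₀, ∀ᵐ a : Fin m → ℝ, ∀ y ∈ Y ∩ N,
      delayMap T ⇑(v + ∑ j, a j • b j) k y ≠ delayMap T ⇑(v + ∑ j, a j • b j) k x := by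
  classical
  -- `h i` takes the value `1` at `T^[i] x` and vanishes at the other points of both orbits
  have hdir : ∀ i : Fin k, ∃ a : Fin m → ℝ,
      delayMap T ⇑(∑ j, a j • b j) k x = EuclideanSpace.single i 1 ∧
      delayMap T ⇑(∑ j, a j • b j) k y₀ = 0 := by
    intro i
    obtain ⟨a, ha⟩ := hb (Finset.univ.image (fun i : Fin k ↦ T^[i] x) ∪
      Finset.univ.image (fun i : Fin k ↦ T^[i] y₀))
      ((Finset.card_union_le _ _).trans (add_le_add
        (Finset.card_image_le.trans (by simp)) (Finset.card_image_le.trans (by simp))))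
      (fun p ↦ algebraMap ℝ _ (if p = T^[i] x then 1 else 0))
    refine ⟨a, ?_, ?_⟩
    · ext j
      have h1 := apply_eq_of_sub_mem_flatIdeal (ha (T^[j] x) (by simp))
      refine h1.trans ?_
      change (if T^[j] x = T^[i] x then (1 : ℝ) else 0) = _
      have : T^[j] x = T^[i] x ↔ j = i := hx.eq_iff (a := j) (b := i)
      simp [this]
    · ext j
      have h1 := apply_eq_of_sub_mem_flatIdeal (ha (T^[j] y₀) (by simp))
      refine h1.trans ?_
      change (if T^[j] y₀ = T^[i] x then (1 : ℝ) else 0) = _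
      rw [if_neg (hxy j i)]
      rfl
  choose A hAx hAy using hdir
  set h : Fin k → Observable d r M := fun i ↦ ∑ j, A i j • b j
  choose K hK using fun i ↦ exists_lipschitzWith_delayMap hρ hr hT (h i) k
  set K₂ : ℝ≥0 := ∑ i, K i
  let L : M → EuclideanSpace ℝ (Fin k) →ₗ[ℝ] EuclideanSpace ℝ (Fin k) := fun y ↦
    ∑ i, (LinearMap.proj i ∘ₗ (WithLp.linearEquiv 2 ℝ (Fin k → ℝ)).toLinearMap).smulRight
      (delayMap T (h i) k x - delayMap T (h i) k y)
  have hLapply : ∀ y s, L y s = ∑ i, s i • (delayMap T (h i) k x - delayMap T (h i) k y) := by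
    intro y s
    simp [L]
  have hLip : ∀ y z s, ‖L y s - L z s‖ ≤ K₂ * ‖s‖ * dist y z := by
    intro y z s
    rw [hLapply, hLapply, ← Finset.sum_sub_distrib]
    refine (norm_sum_le _ _).trans ?_
    simp only [K₂, NNReal.coe_sum, Finset.sum_mul]
    refine Finset.sum_le_sum fun i _ ↦ ?_
    rw [← smul_sub, sub_sub_sub_cancel_left, norm_smul, ← dist_eq_norm, dist_comm]
    calc ‖s i‖ * dist (delayMap T (h i) k y) (delayMap T (h i) k z)
        ≤ ‖s‖ * (K i * dist y z) :=
          mul_le_mul (PiLp.norm_apply_le s i) ((hK i).dist_le_mul y z) dist_nonneg (norm_nonneg _)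
      _ = K i * ‖s‖ * dist y z := by ring
  have hL0 : ∀ s, L y₀ s = s := by
    intro s
    rw [hLapply]
    simp only [h, hAx, hAy, sub_zero]
    conv_rhs => rw [← (EuclideanSpace.basisFun (Fin k) ℝ).sum_repr s]
    simp
  -- on the ball of radius `ρ`, `L y` differs by at most `1 / 2` from `L y₀ = id`
  set ρ : ℝ := (2 * (K₂ + 1))⁻¹ with hρdef
  have hρ0 : 0 < ρ := by positivity
  have hK₂ρ : (K₂ : ℝ) * ρ ≤ 1 / 2 := by
    rw [hρdef, mul_inv, ← mul_assoc, mul_comm _ (2 : ℝ)⁻¹, mul_assoc, ← div_eq_mul_inv]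
    have : (K₂ : ℝ) / (K₂ + 1) ≤ 1 := (div_le_one (by positivity)).2 (by linarith)
    linarith
  have hLlow : ∀ y ∈ Metric.closedBall y₀ ρ, ∀ s, ‖s‖ ≤ 2 * ‖L y s‖ := by
    intro y hy s
    have h1 := hLip y₀ y s
    rw [hL0, dist_comm] at h1
    have h2 : (K₂ : ℝ) * ‖s‖ * dist y y₀ ≤ 1 / 2 * ‖s‖ := by
      calc (K₂ : ℝ) * ‖s‖ * dist y y₀ ≤ K₂ * ‖s‖ * ρ := by
            gcongr
            exact hy
        _ = K₂ * ρ * ‖s‖ := by ring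
        _ ≤ _ := by gcongr
    have h3 := norm_sub_norm_le s (L y s)
    linarith
  refine ⟨Metric.closedBall y₀ ρ, Metric.closedBall_mem_nhds _ hρ0, ?_⟩
  have hopen := isOpen_setOf_forall_delayMap_ne (d := d) (r := r) hT.continuous b v k x
    (hY.inter_right (Metric.isClosed_closedBall (x := y₀) (ε := ρ)))
  let Φ : EuclideanSpace ℝ (Fin k) →ₗ[ℝ] (Fin m → ℝ) :=
    ∑ i, (LinearMap.proj i ∘ₗ (WithLp.linearEquiv 2 ℝ (Fin k → ℝ)).toLinearMap).smulRight (A i)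
  have hΦ : ∀ s y, delayMap T ⇑(∑ j, Φ s j • b j) k y = ∑ i, s i • delayMap T (h i) k y := by
    intro s y
    have h1 : ∑ j, Φ s j • b j = ∑ i, s i • h i := by
      simp only [Φ, h, LinearMap.sum_apply, Finset.sum_apply, Finset.smul_sum, Finset.sum_smul]
      rw [Finset.sum_comm]
      simp [mul_smul]
    rw [h1]
    have := map_sum (delayLinearMap d r T k y) (fun i ↦ s i • h i) Finset.univ
    exact this
  refine ae_mem_of_ae_add_linearMap_mem Φ volume volume hopen.measurableSet fun a ↦ ?_
  set w : Observable d r M := v + ∑ j, a j • b j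
  obtain ⟨K₁, hK₁⟩ := exists_lipschitzWith_delayMap hρ hr hT w k
  have hnull := volume_setOf_exists_add_apply_eq_zero (N := Y ∩ Metric.closedBall y₀ ρ)
    ((dimH_mono inter_subset_left).trans_lt hdim)
    (c := fun y ↦ delayMap T w k x - delayMap T w k y) (L := L) (K₁ := K₁) (K₂ := K₂)
    (fun y _ z _ ↦ by
      rw [sub_sub_sub_cancel_left, ← dist_eq_norm, dist_comm]
      exact hK₁.dist_le_mul y z)
    (fun y hy ↦ hLlow y hy.2) (fun y _ z _ ↦ hLip y z)
  filter_upwards [compl_mem_ae_iff.2 hnull] with s hs y hy heq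
  refine hs ⟨y, hy, ?_⟩
  rw [delayMap_add_sum_add, delayMap_add_sum_add, hΦ, hΦ] at heq
  rw [hLapply]
  simp only [smul_sub, Finset.sum_sub_distrib]
  rw [sub_add_sub_comm, sub_eq_zero]
  exact heq.symm

/-- For almost every observable of an interpolating family, no point of `Y` other than `x` has the
same delay coordinates as `x`. The finitely many points whose delay orbit meets that of `x` are
treated one by one, since the delay coordinates at such a point depend on those at `x`: for them it
is enough that a single coordinate can be varied. -/
theorem ae_forall_delayMap_ne (hρ : IsRiemannianMetric d M) (hr : 1 ≤ r)
    (hT : ContMDiff (𝓡 d) (𝓡 d) r T) (hTinj : Injective T) {k m : ℕ} {b : Fin m → Observable d r M}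
    (hb : IsInterpolating hr (k + k) b) (v : Observable d r M) {x : M}
    (hx : Injective fun i : Fin k ↦ T^[i] x) {Y : Set M} (hY : IsCompact Y) (hdim : dimH Y < k) :
    ∀ᵐ a : Fin m → ℝ, ∀ y ∈ Y, y ≠ x →
      delayMap T ⇑(v + ∑ j, a j • b j) k y ≠ delayMap T ⇑(v + ∑ j, a j • b j) k x := by
  classical
  have : SecondCountableTopology M := EMetric.secondCountable_of_sigmaCompact M
  have hk : 0 < k := by
    rcases Nat.eq_zero_or_pos k with rfl | hk
    · simp at hdim
    · exact hk
  set Z : Set M := ⋃ (i : Fin k) (j : Fin k), {y | T^[i] y = T^[j] x}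
  have hZ : Z.Finite := finite_iUnion fun i ↦ finite_iUnion fun j ↦
    Set.Subsingleton.finite fun y hy z hz ↦ hTinj.iterate i (hy.trans hz.symm)
  -- for a fixed `y ≠ x`, vary the observable along a function equal to `1` at `x` and `0` at `y`
  have hZae : ∀ᵐ a : Fin m → ℝ, ∀ y ∈ Z, y ≠ x →
      delayMap T ⇑(v + ∑ j, a j • b j) k y ≠ delayMap T ⇑(v + ∑ j, a j • b j) k x := by
    refine (ae_ball_iff hZ.countable).2 fun y _ ↦ ?_
    by_cases hyx : y = x
    · exact Filter.Eventually.of_forall fun a h ↦ absurd hyx h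
    obtain ⟨a', ha'⟩ := hb {x, y} (Finset.card_le_two.trans (by omega))
      (fun p ↦ algebraMap ℝ _ (if p = x then 1 else 0))
    have hx1 : (∑ j, a' j • b j) x = 1 :=
      (apply_eq_of_sub_mem_flatIdeal (ha' x (by simp))).trans (if_pos rfl)
    have hy1 : (∑ j, a' j • b j) y = 0 :=
      (apply_eq_of_sub_mem_flatIdeal (ha' y (by simp))).trans (if_neg hyx)
    have hopen := isOpen_setOf_forall_delayMap_ne (d := d) (r := r) hT.continuous b v k x
      (isCompact_singleton (x := y))
    have hae := ae_mem_of_ae_add_linearMap_mem (LinearMap.toSpanSingleton ℝ (Fin m → ℝ) a')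
      volume volume hopen.measurableSet fun a ↦ by
        set w : Observable d r M := v + ∑ j, a j • b j with hw
        filter_upwards [compl_mem_ae_iff.2 (measure_singleton (μ := volume) (w y - w x))]
          with t ht z hz heq
        obtain rfl : z = y := hz
        refine ht ?_
        have h1 : ∀ z, (∑ j, (t • a') j • b j) z = t * (∑ j, a' j • b j) z := by
          intro z
          have : ∑ j, (t • a') j • b j = t • ∑ j, a' j • b j := by
            simp [Finset.smul_sum, mul_smul]
          rw [this]
          rfl
        have h2 := congrArg (fun u : EuclideanSpace ℝ (Fin k) ↦ u ⟨0, hk⟩) heq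
        rw [LinearMap.toSpanSingleton_apply] at h2
        simp only [delayMap_add_sum_add] at h2
        change w z + (∑ j, (t • a') j • b j) z = w x + (∑ j, (t • a') j • b j) x at h2
        rw [h1, h1, hx1, hy1] at h2
        change t = w z - w x
        linarith
    filter_upwards [hae] with a ha _ using ha y rfl
  have hloc : ∀ y₀ ∈ Zᶜ, ∃ N ∈ 𝓝 y₀, ∀ᵐ a : Fin m → ℝ, ∀ y ∈ Y ∩ N,
      delayMap T ⇑(v + ∑ j, a j • b j) k y ≠ delayMap T ⇑(v + ∑ j, a j • b j) k x := by
    intro y₀ hy₀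
    refine exists_nhds_ae_delayMap_ne hρ hr hT hb v hx (fun i j hij ↦ hy₀ ?_) hY hdim
    exact mem_iUnion₂.2 ⟨i, j, hij⟩
  choose! N hN hNae using hloc
  obtain ⟨t, htZ, htc, hcov⟩ := TopologicalSpace.countable_cover_nhdsWithin
    (f := N) (s := Zᶜ) fun y hy ↦ mem_nhdsWithin_of_mem_nhds (hN y hy)
  have hcae := (ae_ball_iff htc).2 fun y hy ↦ hNae y (htZ hy)
  filter_upwards [hZae, hcae] with a ha1 ha2 y hyY hyx
  by_cases hyZ : y ∈ Z
  · exact ha1 y hyZ hyx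
  · obtain ⟨z, hz, hyz⟩ := mem_iUnion₂.1 (hcov hyZ)
    exact ha2 z hz y ⟨hyY, hyz⟩

end Delay

/-! ### Immersivity of the delay coordinate map at a point -/

section Immersion

open scoped NNReal

variable {d : ℕ} {r : ℕ∞} {M : Type*} [TopologicalSpace M]
  [ChartedSpace (EuclideanSpace ℝ (Fin d)) M] {T : M → M}

theorem delayMap_contMDiff (hT : ContMDiff (𝓡 d) (𝓡 d) r T) (f : Observable d r M) (k : ℕ) :
    ContMDiff (𝓡 d) (𝓡 k) r (delayMap T f k) := by
  have h1 : ContMDiff (𝓡 d) 𝓘(ℝ, Fin k → ℝ) r fun x ↦ fun i : Fin k ↦ f (T^[i] x) :=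
    contMDiff_pi_space.2 fun i ↦ f.contMDiff.comp (hT.iterate_self i)
  exact (PiLp.contDiff_toLp (p := 2)).contMDiff.comp h1

variable [IsManifold (𝓡 d) r M]

theorem delayMap_comp_symm_contDiffOn (hT : ContMDiff (𝓡 d) (𝓡 d) r T) (f : Observable d r M)
    (k : ℕ) {e : OpenPartialHomeomorph M (EuclideanSpace ℝ (Fin d))}
    (he : e ∈ atlas (EuclideanSpace ℝ (Fin d)) M) :
    ContDiffOn ℝ r (delayMap T f k ∘ e.symm) e.target := by
  rw [← contMDiffOn_iff_contDiffOn]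
  exact (delayMap_contMDiff hT f k).comp_contMDiffOn
    (contMDiffOn_symm_of_mem_maximalAtlas (IsManifold.subset_maximalAtlas he))

theorem hasFDerivAt_zero_of_hasMFDerivAt_zero (hr : 1 ≤ r) {f : M → ℝ} {x : M}
    (hf : HasMFDerivAt (𝓡 d) 𝓘(ℝ, ℝ) f x (0 : EuclideanSpace ℝ (Fin d) →L[ℝ] ℝ)) :
    HasFDerivAt (f ∘ (chartAt (EuclideanSpace ℝ (Fin d)) x).symm)
      (0 : EuclideanSpace ℝ (Fin d) →L[ℝ] ℝ) (chartAt (EuclideanSpace ℝ (Fin d)) x x) := by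
  have hr0 : (r : ℕ∞ω) ≠ 0 := ENat.coe_ne_zero_of_one_le hr
  set e := chartAt (EuclideanSpace ℝ (Fin d)) x
  have hx : x ∈ e.source := mem_chart_source _ x
  have h1 : MDifferentiableAt (𝓡 d) (𝓡 d) e.symm (e x) :=
    ((contMDiffOn_symm_of_mem_maximalAtlas
      (IsManifold.chart_mem_maximalAtlas (n := r) x)).contMDiffAt
        (e.open_target.mem_nhds (e.map_source hx))).mdifferentiableAt hr0
  have hf' : HasMFDerivAt (𝓡 d) 𝓘(ℝ, ℝ) f (e.symm (e x))
      (0 : EuclideanSpace ℝ (Fin d) →L[ℝ] ℝ) := by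
    rw [e.left_inv hx]; exact hf
  have h2 := hf'.comp (e x) h1.hasMFDerivAt
  have h3 : HasMFDerivAt (𝓡 d) 𝓘(ℝ, ℝ) (f ∘ e.symm) (e x)
      (0 : EuclideanSpace ℝ (Fin d) →L[ℝ] ℝ) :=
    hasMFDerivAt_zero_of_apply_eq_zero h2 fun v ↦ rfl
  exact h3.hasFDerivAt

/-- If `d ≤ k`, some combination of an interpolating family has as delay coordinates at `x`, up to
first order, the coordinates of a chart followed by `k - d` zeros. Here `c' i` is the function that
`h ∘ T^[i]` has to match at `x`, so that `h` has to match `c' i ∘ T^[-i]` at `T^[i] x`. -/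
theorem exists_hasFDerivAt_delayMap_leftInverse [T2Space M] (hr : 1 ≤ r)
    {T : M ≃ₘ^r⟮𝓡 d, 𝓡 d⟯ M} {k m : ℕ} (hdk : d ≤ k) {b : Fin m → Observable d r M}
    (hb : IsInterpolating hr k b) {x : M} (hx : Injective fun i : Fin k ↦ T^[i] x) :
    ∃ (a : Fin m → ℝ) (J : EuclideanSpace ℝ (Fin d) →L[ℝ] EuclideanSpace ℝ (Fin k))
      (P : EuclideanSpace ℝ (Fin k) →ₗ[ℝ] EuclideanSpace ℝ (Fin d)), (∀ u, P (J u) = u) ∧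
      HasFDerivAt (delayMap T ⇑(∑ j, a j • b j) k ∘ (chartAt (EuclideanSpace ℝ (Fin d)) x).symm) J
        (chartAt (EuclideanSpace ℝ (Fin d)) x x) := by
  classical
  set e := chartAt (EuclideanSpace ℝ (Fin d)) x with he
  have hxs : x ∈ e.source := mem_chart_source _ x
  obtain ⟨ψ, c, hψ, hc⟩ := exists_bump_coordinates (d := d) (r := r) x
  let c' : Fin k → Observable d r M := fun i ↦ if h : (i : ℕ) < d then c ⟨i, h⟩ else 0
  let J' : Fin k → EuclideanSpace ℝ (Fin d) →L[ℝ] ℝ := fun i ↦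
    if h : (i : ℕ) < d then EuclideanSpace.proj ⟨i, h⟩ else 0
  have hc' : ∀ i, HasFDerivAt (c' i ∘ e.symm) (J' i) (e x) := by
    intro i
    by_cases h : (i : ℕ) < d
    · simp only [c', J', dif_pos h]
      refine (EuclideanSpace.proj (𝕜 := ℝ) (⟨i, h⟩ : Fin d)).hasFDerivAt.congr_of_eventuallyEq ?_
      have hcont : Filter.Tendsto e.symm (𝓝 (e x)) (𝓝 x) := by
        have := e.symm.continuousAt (x := e x) (e.map_source hxs)
        rwa [ContinuousAt, e.left_inv hxs] at this
      filter_upwards [hcont.eventually hψ, e.open_target.mem_nhds (e.map_source hxs)] with z hz hzt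
      change c ⟨i, h⟩ (e.symm z) = z ⟨i, h⟩
      rw [(hc _ hz).2, ← he, e.right_inv hzt]
    · simp only [c', J', dif_neg h]
      exact hasFDerivAt_const (0 : ℝ) (e x)
  let Tinv : ℕ → C^r⟮𝓡 d, M; 𝓡 d, M⟯ := fun i ↦ ⟨T.symm^[i], T.symm.contMDiff.iterate_self i⟩
  obtain ⟨a, ha⟩ := hb (Finset.univ.image fun i : Fin k ↦ T^[i] x)
    (Finset.card_image_le.trans (by simp))
    (Function.extend (fun i : Fin k ↦ T^[i] x) (fun i ↦ (c' i).comp (Tinv i)) 0)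
  set h := ∑ j, a j • b j
  have hcomp : ∀ i : Fin k, HasFDerivAt (fun z ↦ h (T^[i] (e.symm z))) (J' i) (e x) := by
    intro i
    have h1 := ha (T^[i] x) (by simp)
    rw [hx.extend_apply] at h1
    have h2 : MDifferentiableAt (𝓡 d) (𝓡 d) T^[i] x :=
      (T.contMDiff.iterate_self i).mdifferentiable (ENat.coe_ne_zero_of_one_le hr) x
    have h3 : HasMFDerivAt (𝓡 d) 𝓘(ℝ, ℝ) (⇑(h - (c' i).comp (Tinv i)) ∘ T^[i]) x
        (0 : EuclideanSpace ℝ (Fin d) →L[ℝ] ℝ) :=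
      hasMFDerivAt_zero_of_apply_eq_zero (h1.2.comp x h2.hasMFDerivAt) fun v ↦ rfl
    have h4 := (hasFDerivAt_zero_of_hasMFDerivAt_zero hr h3).add (hc' i)
    rw [zero_add] at h4
    refine h4.congr_of_eventuallyEq (Filter.Eventually.of_forall fun z ↦ ?_)
    change h (T^[i] (e.symm z)) = h (T^[i] (e.symm z)) -
      c' i (T.symm^[i] (T^[i] (e.symm z))) + c' i (e.symm z)
    rw [(LeftInverse.iterate (T.symm_apply_apply) i : LeftInverse T.symm^[i] T^[i])]
    ring
  let P : EuclideanSpace ℝ (Fin k) →ₗ[ℝ] EuclideanSpace ℝ (Fin d) :=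
    (WithLp.linearEquiv 2 ℝ (Fin d → ℝ)).symm.toLinearMap ∘ₗ
      (LinearMap.funLeft ℝ ℝ (Fin.castLE hdk)) ∘ₗ (WithLp.linearEquiv 2 ℝ (Fin k → ℝ)).toLinearMap
  refine ⟨a, (PiLp.continuousLinearEquiv 2 ℝ (fun _ : Fin k ↦ ℝ)).symm.toContinuousLinearMap.comp
    (ContinuousLinearMap.pi J'), P, fun u ↦ ?_, ?_⟩
  · ext i
    simp [P, J', LinearMap.funLeft]
  · exact (PiLp.continuousLinearEquiv 2 ℝ
      (fun _ : Fin k ↦ ℝ)).symm.toContinuousLinearMap.hasFDerivAt.comp (e x)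
        (hasFDerivAt_pi.2 hcomp)

/-- For almost every observable of an interpolating family, the delay coordinate map is an immersion
at `x`: vary the observable along a function whose delay coordinate map is an immersion at `x`. -/
theorem ae_exists_injective_hasFDerivAt_delayMap [T2Space M] (hr : 1 ≤ r)
    {T : M ≃ₘ^r⟮𝓡 d, 𝓡 d⟯ M} {k m : ℕ} (hdk : d ≤ k) {b : Fin m → Observable d r M}
    (hb : IsInterpolating hr k b) (v : Observable d r M) {x : M}
    (hx : Injective fun i : Fin k ↦ T^[i] x) :
    ∀ᵐ a : Fin m → ℝ, ∃ D : EuclideanSpace ℝ (Fin d) →L[ℝ] EuclideanSpace ℝ (Fin k),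
      HasFDerivAt (delayMap T ⇑(v + ∑ j, a j • b j) k ∘
        (chartAt (EuclideanSpace ℝ (Fin d)) x).symm) D (chartAt (EuclideanSpace ℝ (Fin d)) x x) ∧
      Injective D := by
  have hr0 : (r : ℕ∞ω) ≠ 0 := ENat.coe_ne_zero_of_one_le hr
  set e := chartAt (EuclideanSpace ℝ (Fin d)) x with he
  have hxs : x ∈ e.source := mem_chart_source _ x
  have hdiff : ∀ f : Observable d r M, HasFDerivAt (delayMap T f k ∘ e.symm)
      (fderiv ℝ (delayMap T f k ∘ e.symm) (e x)) (e x) := fun f ↦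
    (((delayMap_comp_symm_contDiffOn T.contMDiff f k (chart_mem_atlas _ x)).contDiffAt
      (e.open_target.mem_nhds (e.map_source hxs))).differentiableAt hr0).hasFDerivAt
  set B : Fin m → EuclideanSpace ℝ (Fin d) →L[ℝ] EuclideanSpace ℝ (Fin k) := fun j ↦
    fderiv ℝ (delayMap T (b j) k ∘ e.symm) (e x)
  set D : (Fin m → ℝ) → EuclideanSpace ℝ (Fin d) →L[ℝ] EuclideanSpace ℝ (Fin k) := fun a ↦
    fderiv ℝ (delayMap T v k ∘ e.symm) (e x) + ∑ j, a j • B j with hD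
  have hDderiv : ∀ a, HasFDerivAt (delayMap T ⇑(v + ∑ j, a j • b j) k ∘ e.symm) (D a) (e x) := by
    intro a
    refine ((hdiff v).add (HasFDerivAt.fun_sum fun j _ ↦
      (hdiff (b j)).const_smul (a j))).congr_of_eventuallyEq
        (Filter.Eventually.of_forall fun z ↦ ?_)
    exact delayMap_add_sum b v a k (e.symm z)
  obtain ⟨a', J, P, hPJ, hJ⟩ := exists_hasFDerivAt_delayMap_leftInverse hr hdk hb hx
  have hDJ : ∀ a (t : ℝ), D (a + t • a') = D a + t • J := by
    intro a t
    have h1 := ((hDderiv a).add (hJ.const_smul t)).congr_of_eventuallyEq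
      (f₁ := delayMap T ⇑(v + ∑ j, (a + t • a') j • b j) k ∘ e.symm)
      (Filter.Eventually.of_forall fun z ↦ by
        have h2 : ∑ j, (t • a') j • b j = t • ∑ j, a' j • b j := by
          simp [Finset.smul_sum, mul_smul]
        have h3 := delayMap_add_sum_add (T := T) b v a (t • a') k (e.symm z)
        rw [h2] at h3
        exact h3)
    exact (hDderiv _).unique h1
  have hcont : Continuous D := by fun_prop
  have hopen : IsOpen {a | Injective (D a)} :=
    ContinuousLinearMap.isOpen_injective.preimage hcont
  have hae := ae_mem_of_ae_add_linearMap_mem (LinearMap.toSpanSingleton ℝ (Fin m → ℝ) a')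
    volume volume hopen.measurableSet fun a ↦ by
      filter_upwards [ae_injective_add_smul (D a) J P hPJ] with t ht
      change Injective (D (a + LinearMap.toSpanSingleton ℝ (Fin m → ℝ) a' t))
      rwa [LinearMap.toSpanSingleton_apply, hDJ]
  filter_upwards [hae] with a ha using ⟨D a, hDderiv a, ha⟩

end Immersion

section PointwiseInverse

open scoped NNReal

variable {d : ℕ} {r : ℕ∞} {M : Type*} [MetricSpace M]
  [ChartedSpace (EuclideanSpace ℝ (Fin d)) M] [IsManifold (𝓡 d) 1 M]
  [RiemannianBundle (fun x : M ↦ TangentSpace (𝓡 d) x)]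
  [IsContinuousRiemannianBundle (EuclideanSpace ℝ (Fin d)) (fun x : M ↦ TangentSpace (𝓡 d) x)]

/-- A continuous map that is an immersion at `x` and takes the value at `x` nowhere else on `Y` has
a pointwise Lipschitz inverse at `x`: near `x` by differentiability, elsewhere by compactness. -/
theorem IsRiemannianMetric.exists_dist_le_mul_norm_sub (hρ : IsRiemannianMetric d M)
    {F : Type*} [NormedAddCommGroup F] [NormedSpace ℝ F] {φ : M → F} (hφ : Continuous φ) {x : M}
    {D : EuclideanSpace ℝ (Fin d) →L[ℝ] F}
    (hD : HasFDerivAt (φ ∘ (chartAt (EuclideanSpace ℝ (Fin d)) x).symm) D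
      (chartAt (EuclideanSpace ℝ (Fin d)) x x)) (hDinj : Injective D) {Y : Set M} (hY : IsCompact Y)
    (hne : ∀ y ∈ Y, y ≠ x → φ y ≠ φ x) :
    ∃ C : ℝ, 0 ≤ C ∧ ∀ y ∈ Y, dist x y ≤ C * ‖φ x - φ y‖ := by
  set e := chartAt (EuclideanSpace ℝ (Fin d)) x
  have hxs : x ∈ e.source := mem_chart_source _ x
  obtain ⟨C₁, hC₁⟩ := hρ.eventually_dist_le_chartAt x
  obtain ⟨C₂, hC₂⟩ := hD.exists_eventually_norm_sub_le hDinj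
  have hnear : ∀ᶠ y in 𝓝 x, dist x y ≤ C₁ * C₂ * ‖φ x - φ y‖ := by
    filter_upwards [hC₁, (e.continuousAt hxs).eventually hC₂, e.open_source.mem_nhds hxs]
      with y hy1 hy2 hys
    simp only [comp_apply, e.left_inv hxs, e.left_inv hys] at hy2
    rw [norm_sub_rev (φ x), mul_assoc]
    exact hy1.trans (mul_le_mul_of_nonneg_left hy2 C₁.2)
  obtain ⟨U, hU, hUo, hxU⟩ := eventually_nhds_iff.1 hnear
  have hcomp : IsCompact (Y \ U) := hY.diff hUo
  have hfar : ∃ C₃ : ℝ, ∀ y ∈ Y \ U, ‖dist x y / ‖φ x - φ y‖‖ ≤ C₃ := by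
    refine hcomp.exists_bound_of_continuousOn (ContinuousOn.div (by fun_prop) (by fun_prop) ?_)
    intro y hy h0
    refine hne y hy.1 (fun h ↦ hy.2 (h ▸ hxU)) ?_
    exact (sub_eq_zero.1 (norm_eq_zero.1 h0)).symm
  obtain ⟨C₃, hC₃⟩ := hfar
  refine ⟨max (C₁ * C₂) C₃, le_max_of_le_left (by positivity), fun y hy ↦ ?_⟩
  by_cases hyU : y ∈ U
  · exact (hU y hyU).trans (mul_le_mul_of_nonneg_right (le_max_left _ _) (norm_nonneg _))
  · have hpos : 0 < ‖φ x - φ y‖ := by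
      refine norm_pos_iff.2 (sub_ne_zero.2 (Ne.symm (hne y hy fun h ↦ hyU (h ▸ hxU))))
    have h1 := (le_abs_self _).trans (hC₃ y ⟨hy, hyU⟩)
    exact ((div_le_iff₀ hpos).1 h1).trans
      (mul_le_mul_of_nonneg_right (le_max_right _ _) (norm_nonneg _))

end PointwiseInverse

/-! ### From pointwise Lipschitz inverses to local diffeomorphisms -/

section LocalDiffeomorphism

open scoped NNReal

/-- Converse of `HasFDerivAt.exists_eventually_norm_sub_le`. -/
theorem HasFDerivAt.injective_of_eventually_norm_sub_le {E F : Type*} [NormedAddCommGroup E]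
    [NormedSpace ℝ E] [NormedAddCommGroup F] [NormedSpace ℝ F] {f : E → F} {f' : E →L[ℝ] F}
    {z₀ : E} (hf : HasFDerivAt f f' z₀) {C : ℝ≥0}
    (hC : ∀ᶠ z in 𝓝 z₀, ‖z - z₀‖ ≤ C * ‖f z - f z₀‖) : Injective f' := by
  rw [injective_iff_map_eq_zero]
  intro u hu
  have ho := (hasFDerivAt_iff_isLittleO.1 hf).def (c := (2 * (C + 1) : ℝ)⁻¹) (by positivity)
  have hline : Filter.Tendsto (fun t : ℝ ↦ z₀ + t • u) (𝓝[≠] 0) (𝓝 z₀) := by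
    have : Continuous fun t : ℝ ↦ z₀ + t • u := by fun_prop
    exact (this.tendsto' 0 z₀ (by simp)).mono_left nhdsWithin_le_nhds
  obtain ⟨t, ⟨ht1, ht2⟩, ht0⟩ :=
    ((hline.eventually (hC.and ho)).and self_mem_nhdsWithin).exists
  rw [add_sub_cancel_left] at ht1 ht2
  rw [map_smul, hu, smul_zero, sub_zero] at ht2
  have h1 : (C : ℝ) * (2 * (C + 1) : ℝ)⁻¹ ≤ 1 / 2 := by
    rw [← div_eq_mul_inv, div_le_iff₀ (by positivity)]
    linarith
  have h2 : ‖t • u‖ ≤ 1 / 2 * ‖t • u‖ :=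
    calc ‖t • u‖ ≤ C * ((2 * (C + 1) : ℝ)⁻¹ * ‖t • u‖) :=
          ht1.trans (mul_le_mul_of_nonneg_left ht2 C.2)
      _ = C * (2 * (C + 1) : ℝ)⁻¹ * ‖t • u‖ := by ring
      _ ≤ _ := mul_le_mul_of_nonneg_right h1 (norm_nonneg _)
  have h3 : t • u = 0 := norm_le_zero_iff.1 (by linarith)
  exact (smul_eq_zero.1 h3).resolve_left ht0

theorem EuclideanSpace.norm_le_sum_norm {d : ℕ} (u : EuclideanSpace ℝ (Fin d)) :
    ‖u‖ ≤ ∑ i, ‖u i‖ := by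
  conv_lhs => rw [← (EuclideanSpace.basisFun (Fin d) ℝ).sum_repr u]
  refine (norm_sum_le _ _).trans_eq (Finset.sum_congr rfl fun i _ ↦ ?_)
  simp [norm_smul]

/-- An immersion `F` of an open subset of `ℝ^d` extends locally, by adding a complement `W` of the
range of its differential, to a diffeomorphism `(z, w) ↦ F z + w` of open sets. -/
theorem exists_openPartialHomeomorph_extending_immersion {d k : ℕ} {r : ℕ∞} (hr : 1 ≤ r)
    {s : Set (EuclideanSpace ℝ (Fin d))} (hs : IsOpen s)
    {F : EuclideanSpace ℝ (Fin d) → EuclideanSpace ℝ (Fin k)} (hF : ContDiffOn ℝ r F s)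
    {z₀ : EuclideanSpace ℝ (Fin d)} (hz₀ : z₀ ∈ s)
    {D : EuclideanSpace ℝ (Fin d) →L[ℝ] EuclideanSpace ℝ (Fin k)} (hD : HasFDerivAt F D z₀)
    (hinj : Injective D) :
    ∃ (W : Submodule ℝ (EuclideanSpace ℝ (Fin k)))
      (A : (EuclideanSpace ℝ (Fin d) × W) ≃L[ℝ] EuclideanSpace ℝ (Fin k))
      (Θ : OpenPartialHomeomorph (EuclideanSpace ℝ (Fin d) × W) (EuclideanSpace ℝ (Fin k))),
      (∀ z, A (z, 0) = D z) ∧ (∀ z, Θ (z, 0) = F z) ∧ (z₀, 0) ∈ Θ.source ∧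
      (∀ p ∈ Θ.source, p.1 ∈ s) ∧ ContDiffOn ℝ r Θ Θ.source ∧
      ContDiffOn ℝ r Θ.symm Θ.target := by
  have hr0 : (r : ℕ∞ω) ≠ 0 := ENat.coe_ne_zero_of_one_le hr
  obtain ⟨W, hW⟩ := Submodule.exists_isCompl (LinearMap.range D.toLinearMap)
  let A' : (EuclideanSpace ℝ (Fin d) × W) →L[ℝ] EuclideanSpace ℝ (Fin k) := D.coprod W.subtypeL
  have hA'apply : ∀ p, A' p = D p.1 + p.2 := fun p ↦ by simp [A']
  have hA'inj : Injective A' := by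
    rw [injective_iff_map_eq_zero]
    rintro ⟨z, w⟩ h
    rw [hA'apply] at h
    have h1 : (w : EuclideanSpace ℝ (Fin k)) = 0 := by
      refine (Submodule.disjoint_def.1 hW.disjoint) _ ?_ w.2
      rw [eq_neg_of_add_eq_zero_right h]
      exact Submodule.neg_mem _ ⟨z, rfl⟩
    have h2 : D z = 0 := by simpa [h1] using h
    have h3 : z = 0 := hinj (h2.trans (map_zero D).symm)
    simp [h3, Subtype.ext_iff, h1]
  have hA'surj : Surjective A' := by
    intro u
    obtain ⟨_, ⟨z, rfl⟩, w, hw, huw⟩ := Submodule.mem_sup.1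
      (hW.sup_eq_top ▸ Submodule.mem_top : u ∈ LinearMap.range D.toLinearMap ⊔ W)
    exact ⟨(z, ⟨w, hw⟩), by rw [hA'apply]; exact huw⟩
  let A : (EuclideanSpace ℝ (Fin d) × W) ≃L[ℝ] EuclideanSpace ℝ (Fin k) :=
    (LinearEquiv.ofBijective A'.toLinearMap ⟨hA'inj, hA'surj⟩).toContinuousLinearEquiv
  have hAA' : (A : (EuclideanSpace ℝ (Fin d) × W) →L[ℝ] EuclideanSpace ℝ (Fin k)) = A' := by
    ext <;> rfl
  let H : EuclideanSpace ℝ (Fin d) × W → EuclideanSpace ℝ (Fin k) := fun p ↦ F p.1 + p.2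
  set Ω : Set (EuclideanSpace ℝ (Fin d) × W) := s ×ˢ univ
  have hΩ : IsOpen Ω := hs.prod isOpen_univ
  have hH : ContDiffOn ℝ r H Ω := by
    refine ContDiffOn.add (hF.comp contDiffOn_fst fun p hp ↦ hp.1) ?_
    exact (W.subtypeL.contDiff.comp contDiff_snd).contDiffOn
  have hz₀Ω : (z₀, (0 : W)) ∈ Ω := ⟨hz₀, mem_univ _⟩
  have hHat : ContDiffAt ℝ r H (z₀, 0) := hH.contDiffAt (hΩ.mem_nhds hz₀Ω)
  have hHD : HasFDerivAt H
      (A : (EuclideanSpace ℝ (Fin d) × W) →L[ℝ] EuclideanSpace ℝ (Fin k)) (z₀, 0) := by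
    rw [hAA']
    have h1 : HasFDerivAt (fun p : EuclideanSpace ℝ (Fin d) × W ↦ F p.1)
        (D.comp (ContinuousLinearMap.fst ℝ _ _)) (z₀, 0) :=
      HasFDerivAt.comp (z₀, (0 : W)) (by exact hD) hasFDerivAt_fst
    have h2 : HasFDerivAt (fun p : EuclideanSpace ℝ (Fin d) × W ↦ (p.2 : EuclideanSpace ℝ (Fin k)))
        (W.subtypeL.comp (ContinuousLinearMap.snd ℝ _ _)) (z₀, 0) :=
      HasFDerivAt.comp (z₀, (0 : W)) W.subtypeL.hasFDerivAt hasFDerivAt_snd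
    exact h1.add h2
  have hstrict : HasStrictFDerivAt H
      (A : (EuclideanSpace ℝ (Fin d) × W) →L[ℝ] EuclideanSpace ℝ (Fin k)) (z₀, 0) :=
    hHat.hasStrictFDerivAt' hHD hr0
  -- restrict to the points where the differential is invertible: there the inverse is `C^r`
  set O : Set (EuclideanSpace ℝ (Fin d) × W) := Ω ∩ fderiv ℝ H ⁻¹' range
    ((↑) : ((EuclideanSpace ℝ (Fin d) × W) ≃L[ℝ] EuclideanSpace ℝ (Fin k)) → _)
  have hO : IsOpen O := (hH.continuousOn_fderiv_of_isOpen hΩ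
    (by exact_mod_cast hr)).isOpen_inter_preimage hΩ ContinuousLinearEquiv.isOpen
  have hz₀O : (z₀, (0 : W)) ∈ O := ⟨hz₀Ω, A, hHD.fderiv.symm⟩
  let Θ := (hstrict.toOpenPartialHomeomorph H).restrOpen O hO
  have hΘ : ⇑Θ = H := rfl
  have hsource : Θ.source ⊆ O := fun p hp ↦ hp.2
  refine ⟨W, A, Θ, fun z ↦ ?_, fun z ↦ ?_, ?_, fun p hp ↦ (hsource hp).1.1, ?_, ?_⟩
  · change A' (z, 0) = _
    simp [hA'apply]
  · simp [hΘ, H]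
  · exact ⟨hstrict.mem_toOpenPartialHomeomorph_source, hz₀O⟩
  · rw [hΘ]
    exact hH.mono fun p hp ↦ (hsource hp).1
  · intro q hq
    have hp := hsource (Θ.map_target hq)
    obtain ⟨B, hB⟩ := hp.2
    have hat : ContDiffAt ℝ r H (Θ.symm q) := hH.contDiffAt (hΩ.mem_nhds hp.1)
    refine (Θ.contDiffAt_symm (f₀' := B) hq ?_ hat).contDiffWithinAt
    rw [hB]
    exact (hat.differentiableAt hr0).hasFDerivAt

variable {d : ℕ} {r : ℕ∞} {M : Type*} [MetricSpace M] [CompactSpace M]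
  [ChartedSpace (EuclideanSpace ℝ (Fin d)) M] [IsManifold (𝓡 d) r M] [IsManifold (𝓡 d) 1 M]
  [RiemannianBundle (fun x : M ↦ TangentSpace (𝓡 d) x)]
  [IsContinuousRiemannianBundle (EuclideanSpace ℝ (Fin d)) (fun x : M ↦ TangentSpace (𝓡 d) x)]

/-- The inverse of `eventually_dist_le_chartAt`: a chart is Lipschitz at its centre, because its
coordinates extend to observables. -/
theorem IsRiemannianMetric.eventually_chartAt_le_dist (hρ : IsRiemannianMetric d M) (x : M) :
    ∃ C : ℝ≥0, ∀ᶠ y in 𝓝 x, ‖chartAt (EuclideanSpace ℝ (Fin d)) x y -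
      chartAt (EuclideanSpace ℝ (Fin d)) x x‖ ≤ C * dist x y := by
  obtain ⟨ψ, c, hψ, hc⟩ := exists_bump_coordinates (d := d) (r := 1) x
  choose K hK using fun i ↦ hρ.exists_lipschitzWith (c i).contMDiff
  refine ⟨∑ i, K i, ?_⟩
  filter_upwards [hψ] with y hy
  refine (EuclideanSpace.norm_le_sum_norm _).trans ?_
  rw [NNReal.coe_sum, Finset.sum_mul]
  refine Finset.sum_le_sum fun i _ ↦ ?_
  rw [PiLp.sub_apply, ← (hc y hy).2 i, ← (hc x hψ.self_of_nhds).2 i, ← dist_eq_norm, dist_comm]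
  exact (hK i).dist_le_mul x y

/-- A `C^r` map with a pointwise Lipschitz inverse at `x` is a diffeomorphism from a saturated
neighbourhood of `x` to an embedded submanifold. The Lipschitz bound makes the map an immersion at
`x`, and, since `x` is the only preimage of its image, excludes a neighbourhood of this image from
the compact image of the points far from `x`. -/
theorem IsRiemannianMetric.exists_isDiffeoBetween (hρ : IsRiemannianMetric d M) (hr : 1 ≤ r)
    {k : ℕ} {φ : M → EuclideanSpace ℝ (Fin k)} (hφ : ContMDiff (𝓡 d) (𝓡 k) r φ) {x : M} {C : ℝ}
    (hC0 : 0 ≤ C) (hC : ∀ y, dist x y ≤ C * ‖φ x - φ y‖) :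
    ∃ (U : Set M) (V : Set (EuclideanSpace ℝ (Fin k))), IsOpen U ∧ IsOpen V ∧ x ∈ U ∧ φ x ∈ V ∧
      φ ⁻¹' V = U ∧ IsDiffeoBetween r d φ U (V ∩ range φ) := by
  have hr0 : (r : ℕ∞ω) ≠ 0 := ENat.coe_ne_zero_of_one_le hr
  set e := chartAt (EuclideanSpace ℝ (Fin d)) x with he
  have hxs : x ∈ e.source := mem_chart_source _ x
  have hsymm : ContMDiffOn (𝓡 d) (𝓡 d) r e.symm e.target :=
    contMDiffOn_symm_of_mem_maximalAtlas (IsManifold.chart_mem_maximalAtlas x)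
  have hF : ContDiffOn ℝ r (φ ∘ e.symm) e.target := by
    rw [← contMDiffOn_iff_contDiffOn]
    exact hφ.comp_contMDiffOn hsymm
  have hD : HasFDerivAt (φ ∘ e.symm) (fderiv ℝ (φ ∘ e.symm) (e x)) (e x) :=
    ((hF.contDiffAt (e.open_target.mem_nhds (e.map_source hxs))).differentiableAt hr0).hasFDerivAt
  set D := fderiv ℝ (φ ∘ e.symm) (e x)
  have hinj : Injective D := by
    obtain ⟨K, hK⟩ := hρ.eventually_chartAt_le_dist x
    refine hD.injective_of_eventually_norm_sub_le (C := K * C.toNNReal) ?_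
    have hcont : Filter.Tendsto e.symm (𝓝 (e x)) (𝓝 x) := by
      have := e.symm.continuousAt (x := e x) (e.map_source hxs)
      rwa [ContinuousAt, e.left_inv hxs] at this
    filter_upwards [hcont.eventually hK, e.open_target.mem_nhds (e.map_source hxs)] with z hz hzt
    rw [← he, e.right_inv hzt] at hz
    refine hz.trans ?_
    rw [NNReal.coe_mul, Real.coe_toNNReal C hC0, mul_assoc, norm_sub_rev]
    simp only [comp_apply, e.left_inv hxs]
    exact mul_le_mul_of_nonneg_left (hC _) K.2
  obtain ⟨W, A, Θ, hAD, hΘF, hz₀, hΘs, hΘ, hΘsymm⟩ :=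
    exists_openPartialHomeomorph_extending_immersion hr e.open_target hF (e.map_source hxs) hD hinj
  set U₀ : Set M := e.source ∩ e ⁻¹' {z | (z, (0 : W)) ∈ Θ.source}
  have hU₀ : IsOpen U₀ := e.isOpen_inter_preimage
    (Θ.open_source.preimage (by fun_prop : Continuous fun z ↦ (z, (0 : W))))
  have hcl : IsClosed (φ '' U₀ᶜ) := (hU₀.isClosed_compl.isCompact.image hφ.continuous).isClosed
  set V : Set (EuclideanSpace ℝ (Fin k)) := Θ.target \ φ '' U₀ᶜ
  have hV : IsOpen V := Θ.open_target.sdiff hcl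
  have hφe : ∀ y ∈ e.source, φ y = Θ (e y, 0) := fun y hy ↦ by
    rw [hΘF, comp_apply, e.left_inv hy]
  have hxU₀ : x ∈ U₀ := ⟨hxs, hz₀⟩
  have hxV : φ x ∈ V := by
    refine ⟨hφe x hxs ▸ Θ.map_source hz₀, ?_⟩
    rintro ⟨y, hy, hyx⟩
    have h1 := hC y
    rw [hyx, sub_self, norm_zero, mul_zero] at h1
    exact hy (dist_le_zero.1 h1 ▸ hxU₀)
  have hUU₀ : φ ⁻¹' V ⊆ U₀ := fun y hy ↦ by
    by_contra h
    exact hy.2 (mem_image_of_mem φ h)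
  have hΘφ : ∀ y ∈ φ ⁻¹' V, Θ.symm (φ y) = (e y, 0) := fun y hy ↦ by
    rw [hφe y (hUU₀ hy).1, Θ.left_inv (hUU₀ hy).2]
  set g : EuclideanSpace ℝ (Fin k) → M := fun q ↦ e.symm (Θ.symm q).1
  have hφg : ∀ q ∈ V, (Θ.symm q).2 = 0 → φ (g q) = q := fun q hq hq0 ↦ by
    change (φ ∘ e.symm) (Θ.symm q).1 = q
    rw [← hΘF, ← hq0, Prod.mk.eta, Θ.right_inv hq.1]
  have hS : ∀ q ∈ V, q ∈ range φ ↔ (Θ.symm q).2 = 0 := fun q hq ↦ by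
    constructor
    · rintro ⟨y, rfl⟩
      rw [hΘφ y hq]
    · exact fun hq0 ↦ ⟨g q, hφg q hq hq0⟩
  have hgφ : ∀ y ∈ φ ⁻¹' V, g (φ y) = y := fun y hy ↦ by
    change e.symm (Θ.symm (φ y)).1 = y
    rw [hΘφ y hy, e.left_inv (hUU₀ hy).1]
  refine ⟨φ ⁻¹' V, V, hV.preimage hφ.continuous, hV, hxV, hxV, rfl, ?_, ?_, hφ.contMDiffOn, g, ?_,
    ?_⟩
  · intro z hz
    -- `Θ⁻¹` maps the image to `w = 0`; the linear equivalence `A` identifies this with `range D`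
    let Ψ := (Θ.symm.restrOpen V hV).transHomeomorph A.toHomeomorph
    have hΨ : ∀ q, Ψ q = A (Θ.symm q) := fun q ↦ rfl
    have hΨt : ∀ u ∈ Ψ.target, A.symm u ∈ Θ.source := fun u hu ↦ by
      have h1 := (Ψ.map_target hu).1
      have h2 := hΨ (Ψ.symm u)
      rw [Ψ.right_inv hu] at h2
      rw [h2, A.symm_apply_apply]
      exact Θ.map_target h1
    refine ⟨Ψ, LinearMap.range D.toLinearMap, ⟨hz.1.1, hz.1⟩, ?_, ?_, ?_, ?_⟩
    · rw [LinearMap.finrank_range_of_inj hinj, finrank_euclideanSpace_fin]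
    · exact A.contDiff.comp_contDiffOn (hΘsymm.mono fun q hq ↦ hq.1)
    · exact hΘ.comp A.symm.contDiff.contDiffOn hΨt
    · apply Subset.antisymm
      · rintro _ ⟨q, ⟨⟨hqV, hqr⟩, hqs⟩, rfl⟩
        refine ⟨⟨(Θ.symm q).1, ?_⟩, Ψ.map_source hqs⟩
        change D _ = _
        rw [← hAD, hΨ, ← (hS q hqV).1 hqr]
      · rintro u ⟨⟨w, hw⟩, hu⟩
        have hq := Ψ.map_target hu
        refine ⟨Ψ.symm u, ⟨⟨hq.2, (hS _ hq.2).2 ?_⟩, hq⟩, Ψ.right_inv hu⟩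
        have h1 := hΨ (Ψ.symm u)
        rw [Ψ.right_inv hu] at h1
        rw [← A.injective (((hAD w).trans hw).trans h1)]
  · refine ⟨fun y hy ↦ ⟨hy, mem_range_self y⟩, fun y hy z hz hyz ↦ ?_, ?_⟩
    · rw [← hgφ y hy, hyz, hgφ z hz]
    · rintro _ ⟨hq, y, rfl⟩
      exact ⟨y, hq, rfl⟩
  · refine ⟨hgφ, ?_⟩
    rintro q ⟨hq, hqr⟩
    exact hφg q hq ((hS q hq).1 hqr)
  · intro z hz
    refine ⟨V, g, hV, hz.1, ?_, fun _ _ ↦ rfl⟩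
    have h1 : ContDiffOn ℝ r (fun q ↦ (Θ.symm q).1) V :=
      contDiff_fst.comp_contDiffOn (hΘsymm.mono fun q hq ↦ hq.1)
    exact hsymm.comp h1.contMDiffOn fun q hq ↦ hΘs _ (Θ.map_target hq.1)

end LocalDiffeomorphism

/-! ### Prevalence -/

section Prevalence

/-- A Borel set that contains almost every element of all translates of a finite-dimensional space
is prevalent. -/
theorem isPrevalentBorel_of_ae_add_sum_mem {d : ℕ} {r : ℕ∞} {M : Type*} [TopologicalSpace M]
    [ChartedSpace (EuclideanSpace ℝ (Fin d)) M] [IsManifold (𝓡 d) r M] {m : ℕ}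
    {b : Fin m → Observable d r M}
    {B : Set (Observable d r M)} (hB : MeasurableSet B)
    (h : ∀ v, ∀ᵐ a : Fin m → ℝ, v + ∑ j, a j • b j ∈ B) : IsPrevalentBorel B := by
  set Λ : (Fin m → ℝ) → Observable d r M := fun a ↦ ∑ j, a j • b j
  have hΛ : Continuous Λ := Observable.continuous_linearCombination b
  have hball : volume (Metric.closedBall (0 : Fin m → ℝ) 1) < ⊤ :=
    (isCompact_closedBall _ _).measure_lt_top
  have : IsFiniteMeasure (volume.restrict (Metric.closedBall (0 : Fin m → ℝ) 1)) :=
    ⟨by rwa [Measure.restrict_apply_univ]⟩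
  refine ⟨hB, (volume.restrict (Metric.closedBall (0 : Fin m → ℝ) 1)).map Λ,
    ⟨Λ '' Metric.closedBall 0 1, (isCompact_closedBall _ _).image hΛ, ?_, measure_lt_top _ _⟩,
    fun v ↦ ?_⟩
  · refine lt_of_lt_of_le ?_ (Measure.le_map_apply hΛ.measurable.aemeasurable _)
    refine lt_of_lt_of_le ?_ (measure_mono (subset_preimage_image _ _))
    rw [Measure.restrict_apply_self]
    exact Metric.measure_closedBall_pos _ _ one_pos
  · -- translations of `C^r(M, ℝ)` are continuous, so that `{e | v + e ∈ B}` is Borel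
    rw [ae_map_iff hΛ.measurable.aemeasurable
      ((Observable.continuous_const_add v).measurable hB)]
    exact ae_restrict_of_ae (h v)

/-- The observables whose delay coordinate map has, at `μ`-almost every point, a pointwise Lipschitz
inverse on `Y`. -/
def lipschitzInvertibleObservables {d : ℕ} {r : ℕ∞} {M : Type*} [MetricSpace M]
    [ChartedSpace (EuclideanSpace ℝ (Fin d)) M] [MeasurableSpace M] (T : M → M) (k : ℕ)
    (μ : Measure M) (Y : Set M) : Set (Observable d r M) :=
  {h | ∀ᵐ x ∂μ, ∃ C : ℝ, 0 ≤ C ∧ ∀ y ∈ Y, dist x y ≤ C * ‖delayMap T h k x - delayMap T h k y‖}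

variable {d : ℕ} {r : ℕ∞} {M : Type*} [MetricSpace M] [CompactSpace M]
  [ChartedSpace (EuclideanSpace ℝ (Fin d)) M] [MeasurableSpace M] [BorelSpace M]

/-- It suffices to consider integer constants in the Lipschitz bounds, and each of them defines
a closed condition. -/
theorem measurableSet_setOf_exists_dist_le {T : M → M} (hT : Continuous T) (k : ℕ) (Y : Set M) :
    MeasurableSet {p : M × Observable d r M | ∃ C : ℝ, 0 ≤ C ∧ ∀ y ∈ Y,
      dist p.1 y ≤ C * ‖delayMap T p.2 k p.1 - delayMap T p.2 k y‖} := by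
  have : SecondCountableTopology M := EMetric.secondCountable_of_sigmaCompact M
  have hset : {p : M × Observable d r M | ∃ C : ℝ, 0 ≤ C ∧ ∀ y ∈ Y,
      dist p.1 y ≤ C * ‖delayMap T p.2 k p.1 - delayMap T p.2 k y‖} =
      ⋃ n : ℕ, ⋂ y ∈ Y, {p : M × Observable d r M |
        dist p.1 y ≤ n * ‖delayMap T p.2 k p.1 - delayMap T p.2 k y‖} := by
    ext p
    simp only [mem_ofPred_eq, mem_iUnion, mem_iInter]
    constructor
    · rintro ⟨C, -, hC⟩
      obtain ⟨n, hn⟩ := exists_nat_ge C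
      exact ⟨n, fun y hy ↦ (hC y hy).trans (mul_le_mul_of_nonneg_right hn (norm_nonneg _))⟩
    · rintro ⟨n, hn⟩
      exact ⟨n, n.cast_nonneg, hn⟩
  rw [hset]
  refine MeasurableSet.iUnion fun n ↦ (isClosed_biInter fun y _ ↦ ?_).measurableSet
  have h1 := continuous_delayMap (d := d) (r := r) hT k
  have h2 : Continuous fun p : M × Observable d r M ↦ delayMap T p.2 k y :=
    h1.comp (continuous_const.prodMk continuous_snd)
  exact isClosed_le (by fun_prop) (continuous_const.mul (h1.sub h2).norm)

theorem measurableSet_lipschitzInvertibleObservables {T : M → M} (hT : Continuous T) (k : ℕ)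
    (μ : Measure M) [IsProbabilityMeasure μ] (Y : Set M) :
    MeasurableSet (lipschitzInvertibleObservables T k μ Y : Set (Observable d r M)) :=
  measurable_measure_prodMk_right (μ := μ)
    (measurableSet_setOf_exists_dist_le (d := d) (r := r) hT k Y).compl (measurableSet_singleton 0)

theorem injective_iterate_of_notMem_ptsOfPeriod {α : Type*} {T : α → α} (hT : Injective T) {k : ℕ}
    {x : α} (hx : x ∉ ⋃ p ∈ Ico 1 k, ptsOfPeriod T p) : Injective fun i : Fin k ↦ T^[i] x := by
  have key : ∀ i j : Fin k, i < j → T^[i] x ≠ T^[j] x := by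
    intro i j hij heq
    refine hx (mem_iUnion₂.2 ⟨j - i, ⟨by omega, by omega⟩, ?_⟩)
    refine hT.iterate i ?_
    rw [← iterate_add_apply, Nat.add_sub_cancel' (le_of_lt hij), ← heq]
  intro i j hij
  by_contra hne
  rcases lt_or_gt_of_ne hne with h | h
  · exact key i j h hij
  · exact key j i h hij.symm

variable [IsManifold (𝓡 d) r M] [IsManifold (𝓡 d) 1 M]
  [RiemannianBundle (fun x : M ↦ TangentSpace (𝓡 d) x)]
  [IsContinuousRiemannianBundle (EuclideanSpace ℝ (Fin d)) (fun x : M ↦ TangentSpace (𝓡 d) x)]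

/-- For each non-periodic point the exceptional parameters are null; exchange the quantifiers by
Fubini's theorem. -/
theorem ae_mem_lipschitzInvertibleObservables (hρ : IsRiemannianMetric d M) (hr : 1 ≤ r)
    {T : M ≃ₘ^r⟮𝓡 d, 𝓡 d⟯ M} (μ : Measure M) [IsProbabilityMeasure μ] {k m : ℕ}
    (hper : μ (⋃ p ∈ Ico 1 k, ptsOfPeriod T p) = 0) {b : Fin m → Observable d r M}
    (hb : IsInterpolating hr (k + k) b) {Y : Set M} (hY : IsCompact Y) (hdim : dimH Y < k)
    (hdk : d ≤ k) (v : Observable d r M) :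
    ∀ᵐ a : Fin m → ℝ, v + ∑ j, a j • b j ∈ lipschitzInvertibleObservables T k μ Y := by
  have : SecondCountableTopology M := EMetric.secondCountable_of_sigmaCompact M
  have hmeas : Measurable fun p : M × (Fin m → ℝ) ↦ (p.1, v + ∑ j, p.2 j • b j) :=
    measurable_fst.prodMk ((continuous_affine_family b v).measurable.comp measurable_snd)
  have hset : MeasurableSet {p : M × (Fin m → ℝ) | ∃ C : ℝ, 0 ≤ C ∧ ∀ y ∈ Y, dist p.1 y ≤
      C * ‖delayMap T ⇑(v + ∑ j, p.2 j • b j) k p.1 - delayMap T ⇑(v + ∑ j, p.2 j • b j) k y‖} :=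
    hmeas (measurableSet_setOf_exists_dist_le T.continuous k Y)
  refine (Measure.ae_ae_comm hset).1 ?_
  filter_upwards [compl_mem_ae_iff.2 hper] with x hx
  have hinj := injective_iterate_of_notMem_ptsOfPeriod T.injective hx
  have hb' : IsInterpolating hr k b := fun S hS ↦ hb S (hS.trans (Nat.le_add_left k k))
  filter_upwards [ae_forall_delayMap_ne hρ hr T.contMDiff T.injective hb v hinj hY hdim,
    ae_exists_injective_hasFDerivAt_delayMap hr hdk hb' v hinj] with a ha ⟨D, hD, hDinj⟩
  exact hρ.exists_dist_le_mul_norm_sub (delayMap_contMDiff T.contMDiff _ k).continuous hD hDinj hY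
    ha

end Prevalence

theorem theorem1p1 (d : ℕ) (r : ℕ∞) (hr : 1 ≤ r)
    {M : Type*} [MetricSpace M] [CompactSpace M]
    [ChartedSpace (EuclideanSpace ℝ (Fin d)) M]
    [IsManifold (𝓡 d) r M] [IsManifold (𝓡 d) 1 M]
    [RiemannianBundle (fun x : M ↦ TangentSpace (𝓡 d) x)]
    [IsContinuousRiemannianBundle (EuclideanSpace ℝ (Fin d))
      (fun x : M ↦ TangentSpace (𝓡 d) x)]
    (hρ : IsRiemannianMetric d M)
    [MeasurableSpace M] [BorelSpace M]
    (T : M ≃ₘ^r⟮𝓡 d, 𝓡 d⟯ M)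
    (X : Set M) (hX : IsCompact X)
    (μ : Measure M) [IsProbabilityMeasure μ] (hμX : μ Xᶜ = 0)
    (k : ℕ) (hper : μ (⋃ p ∈ Ico 1 k, ptsOfPeriod T p) = 0) :
    IsPrevalent {h : C^(r : ℕ∞ω)⟮𝓡 d, M; 𝓘(ℝ, ℝ), ℝ⟯ |
      (dimH X < k → d ≤ k →
        ∀ᵐ x ∂μ, ∃ C : ℝ, 0 ≤ C ∧ ∀ y ∈ X,
          dist x y ≤ C * ‖delayMap T h k x - delayMap T h k y‖) ∧
      (d < k →
        ∀ᵐ x ∂μ, ∃ (U : Set M) (V : Set (EuclideanSpace ℝ (Fin k))),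
          IsOpen U ∧ IsOpen V ∧ x ∈ U ∧ delayMap T h k x ∈ V ∧
          delayMap T h k ⁻¹' V = U ∧
          IsDiffeoBetween r d (delayMap T h k) U (V ∩ range (delayMap T h k)))} := by
  classical
  -- the resulting family serves all tuples `x, …, T^[k-1] x, y, …, T^[k-1] y`
  obtain ⟨m, b, hb⟩ := exists_interpolating_family (d := d) (M := M) hr (k + k)
  -- each part only contributes a condition when its dimension hypotheses hold
  set B₁ : Set (Observable d r M) :=
    if dimH X < k ∧ d ≤ k then lipschitzInvertibleObservables T k μ X else univ with hB₁
  set B₂ : Set (Observable d r M) :=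
    if d < k then lipschitzInvertibleObservables T k μ univ else univ with hB₂
  have hm₁ : MeasurableSet B₁ := by
    rw [hB₁]
    split_ifs
    exacts [measurableSet_lipschitzInvertibleObservables T.continuous k μ X, MeasurableSet.univ]
  have hm₂ : MeasurableSet B₂ := by
    rw [hB₂]
    split_ifs
    exacts [measurableSet_lipschitzInvertibleObservables T.continuous k μ univ, MeasurableSet.univ]
  refine ⟨B₁ ∩ B₂, fun h hh ↦ ⟨fun hdim hdk ↦ ?_, fun hdk ↦ ?_⟩,
    isPrevalentBorel_of_ae_add_sum_mem (b := b) (hm₁.inter hm₂) fun v ↦ ?_⟩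
  · have h1 := hh.1
    rw [hB₁, if_pos ⟨hdim, hdk⟩] at h1
    exact h1
  · have h2 := hh.2
    rw [hB₂, if_pos hdk] at h2
    filter_upwards [h2] with x ⟨C, hC0, hC⟩
    exact hρ.exists_isDiffeoBetween hr (delayMap_contMDiff T.contMDiff h k) hC0
      fun y ↦ hC y (mem_univ y)
  · have h1 : ∀ᵐ a : Fin m → ℝ, v + ∑ j, a j • b j ∈ B₁ := by
      rw [hB₁]
      split_ifs with hc
      · exact ae_mem_lipschitzInvertibleObservables hρ hr μ hper hb hX hc.1 hc.2 v
      · exact Filter.Eventually.of_forall fun _ ↦ mem_univ _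
    have h2 : ∀ᵐ a : Fin m → ℝ, v + ∑ j, a j • b j ∈ B₂ := by
      rw [hB₂]
      split_ifs with hc
      · exact ae_mem_lipschitzInvertibleObservables hρ hr μ hper hb isCompact_univ
          ((hρ.dimH_le univ).trans_lt (by exact_mod_cast hc)) hc.le v
      · exact Filter.Eventually.of_forall fun _ ↦ mem_univ _
    filter_upwards [h1, h2] with a ha1 ha2 using ⟨ha1, ha2⟩
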